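/- Theorem (generalised Beltrami theorem). Let $M$ be a smooth two-dimensional manifold and let $\nabla$ be a smooth torsion-free connection on the tangent bundle $TM$. Let $R(X,Y)Z=\nabla_X\nabla_YZ-\nabla_Y\nabla_XZ-\nabla_{[X,Y]}Z$ be its curvature and let $R_{ab}$ be its Ricci tensor, $R_{ab}Y^aZ^b=\operatorname{tr}\big(V\mapsto R(V,Y)Z\big)$; equivalently, $(\nabla_a\nabla_b-\nabla_b\nabla_a)X^b=-R_{ab}X^b$ for all vector fields $X^b$. Suppose that $R_{ab}$ is symmetric, and put $Y_{abc}=\nabla_aR_{bc}-\nabla_bR_{ac}$. An unparameterised geodesic of $\nabla$ is a smooth curve $\gamma:J\to M$, defined on an open interval $J\subseteq\mathbb R$, whose velocity field $U$ is nowhere zero and satisfies $\nabla_UU=fU$ along $\gamma$ for some smooth function $f:J\to\mathbb R$. Then $Y_{abc}=0$ on all of $M$ if and only if every point of $M$ lies in the domain of a smooth coordinate chart $\varphi:W\to\mathbb R^2$ (with $W\subseteq M$ open) in which the geodesics of $\nabla$ become straight lines, that is, such that for every unparameterised geodesic $\gamma:J\to W$ the image $\varphi(\gamma(J))$ is contained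 in a straight line of $\mathbb R^2$. -/

import Mathlib

open Set Bundle FiberBundle
open scoped Manifold ContDiff

noncomputable section

namespace AffineSurface

/-- The model plane `ℝ²`. -/
abbrev Plane : Type := EuclideanSpace ℝ (Fin 2)

variable {M : Type*} [TopologicalSpace M] [ChartedSpace Plane M] [IsManifold (𝓡 2) ∞ M]

/-- A (not necessarily continuous) vector field on the surface `M`. -/
abbrev VField (M : Type*) [TopologicalSpace M] [ChartedSpace Plane M]
    [IsManifold (𝓡 2) ∞ M] : Type _ :=
  (x : M) → TangentSpace (𝓡 2) x

/-- Smoothness of a vector field, as a section of the tangent bundle. -/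
def IsSmoothField (X : VField M) : Prop :=
  ContMDiff (𝓡 2) (𝓡 2).tangent ∞ (fun x ↦ (⟨x, X x⟩ : TangentBundle (𝓡 2) M))

/-- A connection on the tangent bundle of the surface `M`. -/
abbrev Connection (M : Type*) [TopologicalSpace M] [ChartedSpace Plane M]
    [IsManifold (𝓡 2) ∞ M] : Type _ :=
  CovariantDerivative (𝓡 2) Plane (TangentSpace (𝓡 2) : M → Type _)

/-- The vector field `∇_X Y`. -/
def nabla (cov : Connection M) (X Y : VField M) : VField M :=
  fun x ↦ cov Y x (X x)

/-- The curvature `R(X, Y) Z = ∇_X ∇_Y Z - ∇_Y ∇_X Z - ∇_[X,Y] Z`. -/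
def curvature (cov : Connection M) (X Y Z : VField M) : VField M :=
  fun x ↦ nabla cov X (nabla cov Y Z) x - nabla cov Y (nabla cov X Z) x
    - nabla cov (VectorField.mlieBracket (𝓡 2) X Y) Z x

/-- The standard basis of `T_x M`, which is `ℝ²` through the preferred chart at `x`. -/
def tangentBasis (x : M) : Module.Basis (Fin 2) ℝ (TangentSpace (𝓡 2) x) :=
  (EuclideanSpace.basisFun (Fin 2) ℝ).toBasis

/-- The Ricci tensor `Ric(Y, Z)` at `x` is the trace of the endomorphism `V ↦ R(V, Y) Z` of `T_x M`;
to evaluate `R` at a tangent vector `V`, the vector is extended to a vector field which is smooth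
near `x`. In abstract indices, with `Ric(Y, Z) = R_ab Y^a Z^b`, this is the convention
`(∇_a ∇_b - ∇_b ∇_a) X^b = - R_ab X^b` (for torsion-free connections). -/
def ricci (cov : Connection M) (Y Z : VField M) : M → ℝ :=
  fun x ↦ ∑ i, (tangentBasis x).coord i
    (curvature cov (extend Plane (tangentBasis x i)) Y Z x)

/-- The covariant derivative of the Ricci tensor,
`(∇_X Ric)(Y, Z) = X (Ric(Y, Z)) - Ric(∇_X Y, Z) - Ric(Y, ∇_X Z)`. -/
def nablaRicci (cov : Connection M) (X Y Z : VField M) : M → ℝ :=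
  fun x ↦ mvfderiv (𝓡 2) (ricci cov Y Z) x (X x)
    - ricci cov (nabla cov X Y) Z x - ricci cov Y (nabla cov X Z) x

/-- The tensor `Y_abc = ∇_a R_bc - ∇_b R_ac`, evaluated on three vector fields:
`(∇_X Ric)(Y, Z) - (∇_Y Ric)(X, Z)`. -/
def tensorY (cov : Connection M) (X Y Z : VField M) : M → ℝ :=
  fun x ↦ nablaRicci cov X Y Z x - nablaRicci cov Y X Z x

/-- The Ricci tensor is symmetric. -/
def HasSymmetricRicci (cov : Connection M) : Prop :=
  ∀ X Y : VField M, IsSmoothField X → IsSmoothField Y → ricci cov X Y = ricci cov Y X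

/-- The tensor `Y_abc` vanishes identically. -/
def TensorYVanishes (cov : Connection M) : Prop :=
  ∀ X Y Z : VField M, IsSmoothField X → IsSmoothField Y → IsSmoothField Z →
    ∀ x, tensorY cov X Y Z x = 0

/-- The velocity vector of a curve at time `t`. -/
def velocity (γ : ℝ → M) (t : ℝ) : TangentSpace (𝓡 2) (γ t) :=
  mfderiv 𝓘(ℝ, ℝ) (𝓡 2) γ t (1 : ℝ)

/-- The covariant derivative `∂U` at time `t` of a vector field `U` along a curve `γ`. In the
coordinate frame `E_i` of the preferred chart at `γ t`, write `U(s) = u^i(s) E_i(γ(s))` for `s` near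
`t`. Then `∂U(t) = (du^i/dt)(t) E_i + u^i(t) ∇_{γ'(t)} E_i`; the second summand is the covariant
derivative of the vector field `u^i(t) E_i` with constant coefficients, which is what `extend`
gives. -/
def covDerivAlong (cov : Connection M) (γ : ℝ → M)
    (U : (s : ℝ) → TangentSpace (𝓡 2) (γ s)) (t : ℝ) : TangentSpace (𝓡 2) (γ t) :=
  let e := trivializationAt Plane (TangentSpace (𝓡 2) : M → Type _) (γ t)
  e.symm (γ t) (deriv (fun s ↦ (e ⟨γ s, U s⟩).2) t)
    + cov (extend Plane (U t)) (γ t) (velocity γ t)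

/-- The acceleration field `∂U` of a curve, where `U` is its velocity field. -/
def acceleration (cov : Connection M) (γ : ℝ → M) (t : ℝ) : TangentSpace (𝓡 2) (γ t) :=
  covDerivAlong cov γ (velocity γ) t

/-- `γ`, restricted to the open interval `J`, is an unparameterised geodesic: a smooth regular
curve whose velocity field `U` satisfies `∂U = f U` for some smooth function `f`. -/
structure IsUnparamGeodesicOn (cov : Connection M) (γ : ℝ → M) (J : Set ℝ) : Prop where
  isOpen : IsOpen J
  ordConnected : J.OrdConnected
  smooth : ContMDiffOn 𝓘(ℝ, ℝ) (𝓡 2) ∞ γ J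
  regular : ∀ t ∈ J, velocity γ t ≠ 0
  accel : ∃ f : ℝ → ℝ, ContDiffOn ℝ ∞ f J ∧
    ∀ t ∈ J, acceleration cov γ t = f t • velocity γ t

/-- In the coordinates `φ`, the geodesics contained in the domain of `φ` are straight lines. -/
def GeodesicsAreStraightIn (cov : Connection M) (φ : OpenPartialHomeomorph M Plane) : Prop :=
  ∀ (γ : ℝ → M) (J : Set ℝ), IsUnparamGeodesicOn cov γ J → MapsTo γ J φ.source →
    ∃ L : AffineSubspace ℝ Plane, Module.finrank ℝ L.direction = 1 ∧ ∀ t ∈ J, φ (γ t) ∈ L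

end AffineSurface

end

/-! If `Y = 0`, consider in a chart the linear system `∂_i ∂_j σ = Γ^k_ij ∂_k σ - R_ij σ`. Taking
`(σ, ∂_0 σ, ∂_1 σ)` as unknowns turns it into `dF = A F` with a 3×3 matrix of 1-forms. In dimension
two the curvature is determined by the symmetric Ricci tensor, so the only obstruction to `A` being
flat is `Y`. Frobenius (`exists_hasFDerivAt_of_flat`) then gives three independent local solutions
(`exists_projective_coordinates`). Along an unparameterised geodesic `c` each of them satisfies the
same scalar equation `w'' = f w' - Ric(c', c') w`, whose solution space is two-dimensional. Hence
the three are linearly dependent there with constant coefficients (`exists_sum_mul_eq_zero`), and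
dividing by `σ_0` shows that `(σ_1/σ_0, σ_2/σ_0)` are coordinates in which geodesics lie on lines.

Conversely, if geodesics are straight, then `Γ(v, v)` is parallel to `v` for every `v`, so `Γ^k_ij =
δ^k_i p_j + δ^k_j p_i` (`christoffel_of_geodesicsAreStraightIn`). Symmetry of Ricci says that `p` is
closed, whence `R_ij = p_i p_j - ∂_i p_j`, and substitution gives `Y = 0` (`cotton_eq_zero_of_eq`).

The bridge between the invariant definitions and these coordinate formulas is `ricci_eq`,
`tensorY_eq` and `dchart_acceleration`. -/

/-! ### Frobenius theorem for linear systems with values in a Banach algebra. -/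

section LinearFrobenius

open Metric Filter Topology

variable {E V : Type*} [NormedAddCommGroup E] [NormedSpace ℝ E]
  [NormedAddCommGroup V] [NormedSpace ℝ V]

/-- A `C²` map is, near any point, bounded and Lipschitz, with quadratic Taylor remainder. -/
lemma ContDiffAt.exists_ball_taylor_bounds {A : E → V} {p : E} (hA : ContDiffAt ℝ 2 A p) :
    ∃ ρ > 0, ∃ C > 0, ∀ y ∈ ball p ρ, ‖A y‖ ≤ C ∧ DifferentiableAt ℝ A y ∧
      ∀ z ∈ ball p ρ, ‖A z - A y‖ ≤ C * ‖z - y‖ ∧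
        ‖A z - A y - fderiv ℝ A y (z - y)‖ ≤ C * ‖z - y‖ ^ 2 := by
  have h1 : ContDiffAt ℝ 1 A p := hA.of_le one_le_two
  obtain ⟨K₁, s₁, hs₁, hK₁⟩ := h1.exists_lipschitzOnWith
  have h2 : ContDiffAt ℝ 1 (fderiv ℝ A) p := hA.fderiv_right (by norm_num)
  obtain ⟨K₂, s₂, hs₂, hK₂⟩ := h2.exists_lipschitzOnWith
  have hd : ∀ᶠ y in 𝓝 p, DifferentiableAt ℝ A y :=
    (hA.eventually (by simp)).mono fun y hy ↦ hy.differentiableAt (by simp)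
  have hb : ∀ᶠ y in 𝓝 p, ‖A y‖ < ‖A p‖ + 1 :=
    hA.continuousAt.norm.eventually_lt_const (by simp)
  obtain ⟨ρ, hρ, hsub⟩ := Metric.mem_nhds_iff.1
    (inter_mem (inter_mem hs₁ hs₂) (hd.and hb))
  refine ⟨ρ, hρ, ‖A p‖ + 1 + K₁ + K₂, by positivity, fun y hy ↦ ⟨?_, (hsub hy).2.1, fun z hz ↦ ?_⟩⟩
  · have := (hsub hy).2.2
    have h1 := K₁.2
    have h2 := K₂.2
    simp only [NNReal.val_eq_coe] at h1 h2
    linarith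
  · have hn := norm_nonneg (A p)
    have k1 : (0 : ℝ) ≤ K₁ := K₁.2
    have k2 : (0 : ℝ) ≤ K₂ := K₂.2
    constructor
    · refine (hK₁.norm_sub_le (hsub hz).1.1 (hsub hy).1.1).trans ?_
      gcongr
      linarith
    -- The mean value inequality is applied on the intersection with `closedBall y ‖z - y‖`, where
    -- the Lipschitz bound on the derivative gives the factor `‖z - y‖`.
    · have key : ‖A z - A y - fderiv ℝ A y (z - y)‖ ≤ (K₂ * ‖z - y‖) * ‖z - y‖ := by
        refine Convex.norm_image_sub_le_of_norm_fderiv_le' (𝕜 := ℝ)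
          (s := ball p ρ ∩ closedBall y ‖z - y‖)
          (fun w hw ↦ (hsub hw.1).2.1) (fun w hw ↦ ?_) ((convex_ball _ _).inter
          (convex_closedBall _ _)) ⟨hy, by simp⟩ ⟨hz, by simp [dist_eq_norm]⟩
        refine (hK₂.norm_sub_le (hsub hw.1).1.2 (hsub hy).1.2).trans ?_
        gcongr
        simpa [dist_eq_norm] using hw.2
      refine key.trans ?_
      rw [mul_assoc, ← sq]
      gcongr
      linarith

lemma HasDerivWithinAt.Ici_of_Icc {α : ℝ → V} {α' : V} {t : ℝ}
    (h : HasDerivWithinAt α α' (Icc 0 1) t) (ht : t ∈ Ico (0 : ℝ) 1) :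
    HasDerivWithinAt α α' (Ici t) t :=
  h.mono_of_mem_nhdsWithin (Icc_mem_nhdsGE_of_mem ht)

variable {𝔸 : Type*} [NormedRing 𝔸] [NormedAlgebra ℝ 𝔸]

/-- Solutions on `[0, 1]` of linear differential equations with small coefficients. -/
lemma exists_linear_ode_solution [CompleteSpace 𝔸] {B : ℝ → 𝔸}
    (hB : ContinuousOn B (Icc 0 1)) (hb : ∀ t ∈ Icc (0 : ℝ) 1, ‖B t‖ ≤ 1 / 2) (v : 𝔸) :
    ∃ α : ℝ → 𝔸, α 0 = v ∧ ∀ t ∈ Icc (0 : ℝ) 1, HasDerivWithinAt α (B t * α t) (Icc 0 1) t := by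
  -- On the ball of radius `‖v‖ + 1` about `v` the speed is at most `(2‖v‖ + 1) / 2`, so in time 1
  -- the solution cannot leave the ball.
  have hpl : IsPicardLindelof (fun t w ↦ B t * w) (tmin := 0) (tmax := 1)
      ⟨0, by simp⟩ v (‖v‖₊ + 1) 0 (‖v‖₊ + 1) 1 := by
    refine ⟨fun t ht ↦ ?_, fun x _ ↦ hB.mul continuousOn_const, fun t ht x hx ↦ ?_, by simp⟩
    · refine LipschitzOnWith.of_dist_le_mul fun x _ y _ ↦ ?_
      rw [dist_eq_norm, dist_eq_norm, ← mul_sub, NNReal.coe_one]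
      refine (norm_mul_le _ _).trans ?_
      gcongr
      exact (hb t ht).trans (by norm_num)
    · have hx' : ‖x‖ ≤ ‖v‖ + (‖v‖ + 1) := by
        have := norm_le_norm_add_norm_sub' x v
        rw [mem_closedBall, dist_eq_norm] at hx
        push_cast at hx
        linarith
      calc ‖B t * x‖ ≤ ‖B t‖ * ‖x‖ := norm_mul_le _ _
        _ ≤ 1 / 2 * (‖v‖ + (‖v‖ + 1)) := by gcongr; exact hb t ht
        _ ≤ _ := by push_cast; linarith
  exact hpl.exists_eq_forall_mem_Icc_hasDerivWithinAt₀

/-- **Frobenius theorem** for linear systems `dF = A F`. -/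
theorem exists_hasFDerivAt_of_flat [CompleteSpace 𝔸] {A : E → E →L[ℝ] 𝔸} {p : E}
    (hA : ContDiffAt ℝ 2 A p)
    (flat : ∀ᶠ y in 𝓝 p, ∀ a b, fderiv ℝ A y a b + A y b * A y a =
      fderiv ℝ A y b a + A y a * A y b) (v : 𝔸) :
    ∃ F : E → 𝔸, F p = v ∧
      ∀ᶠ y in 𝓝 p, HasFDerivAt F (((ContinuousLinearMap.mul ℝ 𝔸).flip (F y)).comp (A y)) y := by
  obtain ⟨ρ₀, hρ₀, C, hC, hbd₀⟩ := hA.exists_ball_taylor_bounds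
  obtain ⟨ρ₁, hρ₁, hflat⟩ := Metric.eventually_nhds_iff_ball.1 flat
  -- The bound `1 / (2C)` makes the coefficient `A (p + t • x) x` of the equation along each ray at
  -- most `1/2`.
  set r := min (min ρ₀ ρ₁) (1 / (2 * C)) with hr
  have hr0 : 0 < r := by positivity
  have hCr : C * r ≤ 1 / 2 := by
    calc C * r ≤ C * (1 / (2 * C)) := by gcongr; exact min_le_right _ _
      _ = 1 / 2 := by field_simp
  have mem : ∀ x : E, ‖x‖ < r → ∀ t ∈ Icc (0 : ℝ) 1, p + t • x ∈ ball p r := by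
    intro x hx t ht
    rw [mem_ball, dist_eq_norm, add_sub_cancel_left, norm_smul, Real.norm_of_nonneg ht.1]
    calc t * ‖x‖ ≤ 1 * ‖x‖ := by gcongr; exact ht.2
      _ < r := by simpa using hx
  have hbd : ∀ y ∈ ball p r, ‖A y‖ ≤ C ∧ DifferentiableAt ℝ A y ∧
      ∀ z ∈ ball p r, ‖A z - A y‖ ≤ C * ‖z - y‖ ∧
        ‖A z - A y - fderiv ℝ A y (z - y)‖ ≤ C * ‖z - y‖ ^ 2 := by
    have hs : ball p r ⊆ ball p ρ₀ := ball_subset_ball ((min_le_left _ _).trans (min_le_left _ _))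
    exact fun y hy ↦ ⟨(hbd₀ y (hs hy)).1, (hbd₀ y (hs hy)).2.1,
      fun z hz ↦ (hbd₀ y (hs hy)).2.2 z (hs hz)⟩
  have hfl : ∀ y ∈ ball p r, ∀ a b, fderiv ℝ A y a b + A y b * A y a =
      fderiv ℝ A y b a + A y a * A y b := fun y hy ↦
    hflat y (ball_subset_ball ((min_le_left _ _).trans (min_le_right _ _)) hy)
  have hline : ∀ (x : E) (t : ℝ), HasDerivAt (fun t : ℝ ↦ p + t • x) x t := fun x t ↦ by
    simpa using ((hasDerivAt_id t).smul_const x).const_add p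
  have hdA : ∀ x : E, ‖x‖ < r → ∀ t ∈ Icc (0 : ℝ) 1,
      HasDerivAt (fun t : ℝ ↦ A (p + t • x)) (fderiv ℝ A (p + t • x) x) t := fun x hx t ht ↦
    (hbd _ (mem x hx t ht)).2.1.hasFDerivAt.comp_hasDerivAt t (hline x t)
  have hsol : ∀ x : E, ‖x‖ < r → ∃ α : ℝ → 𝔸, α 0 = v ∧ ∀ t ∈ Icc (0 : ℝ) 1,
      HasDerivWithinAt α (A (p + t • x) x * α t) (Icc 0 1) t := by
    intro x hx
    refine exists_linear_ode_solution (B := fun t ↦ A (p + t • x) x) ?_ ?_ v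
    · exact fun t ht ↦ ((hdA x hx t ht).continuousAt.clm_apply continuousAt_const).continuousWithinAt
    · intro t ht
      calc ‖A (p + t • x) x‖ ≤ ‖A (p + t • x)‖ * ‖x‖ := ContinuousLinearMap.le_opNorm _ _
        _ ≤ C * r := by gcongr; exact (hbd _ (mem x hx t ht)).1
        _ ≤ 1 / 2 := hCr
  choose! α hα0 hα using hsol
  have hαbd : ∀ x : E, ‖x‖ < r → ∀ t ∈ Icc (0 : ℝ) 1, ‖α x t‖ ≤ ‖v‖ * Real.exp 1 := by
    intro x hx t ht
    have h := norm_le_gronwallBound_of_norm_deriv_right_le (f := α x) (δ := ‖v‖) (K := 1) (ε := 0)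
      (a := 0) (b := 1) (fun t ht ↦ (hα x hx t ht).continuousWithinAt)
      (fun t ht ↦ (hα x hx t (Ico_subset_Icc_self ht)).Ici_of_Icc ht) (by rw [hα0 x hx])
      (fun t ht ↦ ?_) t ht
    · rw [gronwallBound_ε0] at h
      refine h.trans ?_
      gcongr
      linarith [ht.2]
    · have ht' := Ico_subset_Icc_self ht
      calc ‖A (p + t • x) x * α x t‖ ≤ ‖A (p + t • x) x‖ * ‖α x t‖ := norm_mul_le _ _
        _ ≤ ‖A (p + t • x)‖ * ‖x‖ * ‖α x t‖ := by gcongr; exact ContinuousLinearMap.le_opNorm _ _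
        _ ≤ C * r * ‖α x t‖ := by gcongr; exact (hbd _ (mem x hx t ht')).1
        _ ≤ 1 * ‖α x t‖ + 0 := by
          rw [add_zero]; gcongr; linarith
  set N := ‖v‖ * Real.exp 1 with hN
  have hN0 : 0 ≤ N := by positivity
  -- The solution is `F (p + x) = α x 1`, with `α x` the solution along the ray. The expected
  -- variation of `α x t` in direction `h` is `A (p + t • x) (t • h) * α x t`. The error satisfies a
  -- linear equation with a source of order `‖h‖²`, so Gronwall bounds it by a multiple of `‖h‖²` at
  -- `t = 1`.
  have main : ∀ x h : E, ‖x‖ < r → ‖x + h‖ < r →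
      ‖α (x + h) 1 - α x 1 - A (p + x) h * α x 1‖ ≤
        (C * r * N + C * N + (C * r + C) * (C * N)) * (Real.exp 1 - 1) * ‖h‖ ^ 2 := by
    intro x h hx hxh
    set Q := C * r * N + C * N + (C * r + C) * (C * N) with hQ
    have hD : ∀ t ∈ Icc (0 : ℝ) 1, HasDerivWithinAt
        (fun t ↦ α (x + h) t - α x t - A (p + t • x) (t • h) * α x t)
        (A (p + t • (x + h)) (x + h) * α (x + h) t - A (p + t • x) x * α x t -
          ((fderiv ℝ A (p + t • x) x (t • h) + A (p + t • x) h) * α x t +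
            A (p + t • x) (t • h) * (A (p + t • x) x * α x t))) (Icc 0 1) t := by
      intro t ht
      have hth : HasDerivWithinAt (fun t : ℝ ↦ t • h) h (Icc 0 1) t := by
        simpa using ((hasDerivAt_id t).smul_const h).hasDerivWithinAt
      exact ((hα _ hxh t ht).sub (hα x hx t ht)).sub
        (((hdA x hx t ht).hasDerivWithinAt.clm_apply hth).mul (hα x hx t ht))
    have h := norm_le_gronwallBound_of_norm_deriv_right_le
      (δ := 0) (K := 1) (ε := Q * ‖h‖ ^ 2) (fun t ht ↦ (hD t ht).continuousWithinAt)
      (fun t ht ↦ (hD t (Ico_subset_Icc_self ht)).Ici_of_Icc ht) (by simp [hα0 x hx, hα0 _ hxh])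
      (fun t ht ↦ ?_) 1 (by simp)
    · rw [gronwallBound_of_K_ne_0 one_ne_zero] at h
      simp only [one_smul, zero_mul, div_one, sub_zero, mul_one, zero_add] at h
      linarith
    · have ht' := Ico_subset_Icc_self ht
      set y := p + t • x with hy
      set z := p + t • (x + h) with hz
      have hyb : y ∈ ball p r := mem x hx t ht'
      have hzb : z ∈ ball p r := mem _ hxh t ht'
      have hzy : z - y = t • h := by rw [hy, hz, smul_add]; abel
      have hzy' : ‖z - y‖ ≤ ‖h‖ := by
        rw [hzy, norm_smul, Real.norm_of_nonneg ht.1]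
        exact mul_le_of_le_one_left (norm_nonneg _) ht.2.le
      have hαt := hαbd x hx t ht'
      have e1 := (hbd z hzb).1
      have e1' := (hbd y hyb).1
      obtain ⟨e2, e3⟩ := (hbd y hyb).2.2 z hzb
      have hfl' := hfl y hyb x (t • h)
      -- Flatness exchanges `x` and `t • h` in `fderiv ℝ A y`. What remains is a linear term in the
      -- error, plus a Taylor remainder and products of two first-order quantities.
      have split : A z (x + h) * α (x + h) t - A y x * α x t -
          ((fderiv ℝ A y x (t • h) + A y h) * α x t + A y (t • h) * (A y x * α x t)) =
          A z (x + h) * (α (x + h) t - α x t - A y (t • h) * α x t) +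
          (((A z - A y - fderiv ℝ A y (z - y)) x) * α x t + ((A z - A y) h * α x t +
            ((A z - A y) x + A z h) * (A y (t • h) * α x t))) := by
        rw [add_mul _ _ (α x t), ← mul_assoc (A y (t • h)), add_right_comm, ← add_mul, hfl', hzy]
        simp only [sub_apply, map_add]
        noncomm_ring
      rw [split]
      have d1 : ‖A z (x + h) * (α (x + h) t - α x t - A y (t • h) * α x t)‖ ≤
          1 * ‖α (x + h) t - α x t - A y (t • h) * α x t‖ := by
        refine (norm_mul_le _ _).trans ?_
        gcongr
        calc ‖A z (x + h)‖ ≤ ‖A z‖ * ‖x + h‖ := ContinuousLinearMap.le_opNorm _ _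
          _ ≤ C * r := by gcongr
          _ ≤ 1 := by linarith
      have d2 : ‖(A z - A y - fderiv ℝ A y (z - y)) x * α x t‖ ≤ C * ‖h‖ ^ 2 * r * N := by
        refine (norm_mul_le _ _).trans ?_
        gcongr
        refine (ContinuousLinearMap.le_opNorm _ _).trans ?_
        gcongr
        exact e3.trans (by gcongr)
      have d3 : ‖(A z - A y) h * α x t‖ ≤ C * ‖h‖ * ‖h‖ * N := by
        refine (norm_mul_le _ _).trans ?_
        gcongr
        refine (ContinuousLinearMap.le_opNorm _ _).trans ?_
        gcongr
        exact e2.trans (by gcongr)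
      have d4 : ‖A y (t • h) * α x t‖ ≤ C * ‖h‖ * N := by
        refine (norm_mul_le _ _).trans ?_
        rw [← hzy]
        gcongr
        refine (ContinuousLinearMap.le_opNorm _ _).trans ?_
        gcongr
      have d5 : ‖(A z - A y) x + A z h‖ ≤ C * ‖h‖ * r + C * ‖h‖ := by
        refine (norm_add_le _ _).trans (add_le_add ?_ ?_)
        · refine (ContinuousLinearMap.le_opNorm _ _).trans ?_
          gcongr
          exact e2.trans (by gcongr)
        · refine (ContinuousLinearMap.le_opNorm _ _).trans ?_
          gcongr
      have d6 : ‖((A z - A y) x + A z h) * (A y (t • h) * α x t)‖ ≤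
          (C * ‖h‖ * r + C * ‖h‖) * (C * ‖h‖ * N) := by
        refine (norm_mul_le _ _).trans ?_
        gcongr
      refine (norm_add_le _ _).trans (add_le_add d1 ?_)
      refine (norm_add_le _ _).trans ?_
      have := norm_add_le ((A z - A y) h * α x t) (((A z - A y) x + A z h) * (A y (t • h) * α x t))
      calc _ ≤ C * ‖h‖ ^ 2 * r * N + (C * ‖h‖ * ‖h‖ * N +
            (C * ‖h‖ * r + C * ‖h‖) * (C * ‖h‖ * N)) := by linarith
        _ = Q * ‖h‖ ^ 2 := by rw [hQ]; ring
  refine ⟨fun y ↦ α (y - p) 1, ?_, ?_⟩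
  -- The ray with `x = 0` has zero coefficient, so `α 0` is constant.
  · have h := (ODE_solution_unique_of_mem_Icc_right (v := fun _ _ ↦ (0 : 𝔸)) (s := fun _ ↦ univ)
      (K := 0) (f := α 0) (g := fun _ ↦ v) (a := 0) (b := 1)
      (fun t _ ↦ (LipschitzWith.const 0).lipschitzOnWith)
      (fun t ht ↦ (hα 0 (by simpa using hr0) t ht).continuousWithinAt)
      (fun t ht ↦ by
        simpa using (hα 0 (by simpa using hr0) t (Ico_subset_Icc_self ht)).Ici_of_Icc ht)
      (fun _ _ ↦ mem_univ _) continuousOn_const (fun t _ ↦ hasDerivWithinAt_const _ _ _)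
      (fun _ _ ↦ mem_univ _) (hα0 0 (by simpa using hr0)))
    simpa using h (x := 1) (by simp)
  · filter_upwards [ball_mem_nhds p hr0] with y hy
    rw [hasFDerivAt_iff_isLittleO_nhds_zero]
    have hy' : ‖y - p‖ < r := by simpa [dist_eq_norm] using hy
    have hev : ∀ᶠ h : E in 𝓝 0, ‖y - p + h‖ < r := by
      have : Tendsto (fun h : E ↦ ‖y - p + h‖) (𝓝 0) (𝓝 ‖y - p + 0‖) :=
        (continuous_const.add continuous_id).norm.tendsto 0
      exact this.eventually_lt_const (by simpa using hy')
    refine (Asymptotics.IsBigO.of_bound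
      ((C * r * N + C * N + (C * r + C) * (C * N)) * (Real.exp 1 - 1)) ?_).trans_isLittleO
      (Asymptotics.isLittleO_norm_pow_id one_lt_two)
    filter_upwards [hev] with h hh
    have := main (y - p) h hy' hh
    rw [Real.norm_of_nonneg (by positivity)]
    simpa [add_sub_right_comm] using this

/-- Solutions of `dF = A F` are as smooth as `A`. -/
lemma contDiffOn_of_hasFDerivAt_linear {A : E → E →L[ℝ] 𝔸} {F : E → 𝔸} {U : Set E}
    (hU : IsOpen U) (hA : ContDiffOn ℝ ∞ A U)
    (hF : ∀ y ∈ U, HasFDerivAt F (((ContinuousLinearMap.mul ℝ 𝔸).flip (F y)).comp (A y)) y) :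
    ContDiffOn ℝ ∞ F U := by
  rw [contDiffOn_infty]
  intro n
  -- Bootstrap: the equation expresses `dF` through `A` and `F`, so each order of smoothness of `F`
  -- yields the next.
  induction n with
  | zero => exact contDiffOn_zero.2 fun y hy ↦ (hF y hy).continuousAt.continuousWithinAt
  | succ n ih =>
    push_cast
    rw [contDiffOn_succ_iff_fderiv_of_isOpen hU]
    refine ⟨fun y hy ↦ (hF y hy).differentiableAt.differentiableWithinAt, by simp, ?_⟩
    have hA' : ContDiffOn ℝ n A U := hA.of_le (by exact_mod_cast le_top)
    have hmul : ContDiff ℝ n fun w : 𝔸 ↦ (ContinuousLinearMap.mul ℝ 𝔸).flip w :=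
      ((ContinuousLinearMap.mul ℝ 𝔸).flip).contDiff
    have : ContDiffOn ℝ n (fun y ↦ ((ContinuousLinearMap.mul ℝ 𝔸).flip (F y)).comp (A y)) U :=
      (hmul.comp_contDiffOn ih).clm_comp hA'
    exact this.congr fun y hy ↦ (hF y hy).fderiv

end LinearFrobenius

/-! ### Uniqueness for linear differential equations. -/

section LinearODE

variable {V : Type*} [NormedAddCommGroup V] [NormedSpace ℝ V]

/-- A solution of a homogeneous linear differential equation on an open interval which vanishes at
one point vanishes identically. -/
lemma eqOn_zero_of_linear_ode {J : Set ℝ} (hJ : IsOpen J) (hJ' : J.OrdConnected)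
    {B : ℝ → V →L[ℝ] V} (hB : ContinuousOn B J) {w : ℝ → V}
    (hw : ∀ t ∈ J, HasDerivAt w (B t (w t)) t) {t₀ : ℝ} (ht₀ : t₀ ∈ J) (h0 : w t₀ = 0) :
    ∀ t ∈ J, w t = 0 := by
  intro t ht
  -- Enlarging to `[a, b] ⊆ J` puts both times in the interior of a compact interval, on which `B`
  -- is bounded and hence uniformly Lipschitz.
  obtain ⟨a, ha, haJ⟩ : ∃ a < min t₀ t, a ∈ J := by
    have hm : min t₀ t ∈ J := by rcases min_choice t₀ t with h | h <;> rw [h] <;> assumption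
    obtain ⟨ε, hε, hb⟩ := Metric.isOpen_iff.1 hJ _ hm
    exact ⟨min t₀ t - ε / 2, by linarith, hb (by simp [abs_of_pos hε]; linarith)⟩
  obtain ⟨b, hb, hbJ⟩ : ∃ b > max t₀ t, b ∈ J := by
    have hm : max t₀ t ∈ J := by rcases max_choice t₀ t with h | h <;> rw [h] <;> assumption
    obtain ⟨ε, hε, hb⟩ := Metric.isOpen_iff.1 hJ _ hm
    exact ⟨max t₀ t + ε / 2, by linarith, hb (by simp [abs_of_pos hε]; linarith)⟩
  have hsub : Icc a b ⊆ J := hJ'.out haJ hbJ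
  obtain ⟨K, hK⟩ := isCompact_Icc.exists_bound_of_continuousOn (hB.mono hsub)
  have hs : Ioo a b ⊆ J := Ioo_subset_Icc_self.trans hsub
  have hv : ∀ s ∈ Ioo a b, LipschitzOnWith K.toNNReal (B s) univ := by
    intro s hs
    refine ((B s).lipschitz.weaken ?_).lipschitzOnWith
    rw [← norm_toNNReal]
    exact Real.toNNReal_le_toNNReal (hK s (Ioo_subset_Icc_self hs))
  exact ODE_solution_unique_of_mem_Ioo (v := fun t w ↦ B t w) (s := fun _ ↦ univ) (g := fun _ ↦ 0) hv
    ⟨ha.trans_le (min_le_left _ _), (le_max_left _ _).trans_lt hb⟩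
    (fun s h ↦ ⟨hw s (hs h), mem_univ _⟩)
    (fun s _ ↦ ⟨by simpa using hasDerivAt_const s (0 : V), mem_univ _⟩) h0
    ⟨ha.trans_le (min_le_right _ _), (le_max_right _ _).trans_lt hb⟩

end LinearODE

noncomputable section

set_option linter.unusedSectionVars false

namespace AffineSurface

open Filter Topology VectorField

/-! ### Vector fields and connections in a chart. -/

section ChartExpressions

variable {M : Type*} [TopologicalSpace M] [ChartedSpace Plane M] [IsManifold (𝓡 2) ∞ M]

/-- The differential of a chart. -/
def dchart (φ : OpenPartialHomeomorph M Plane) (x : M) : TangentSpace (𝓡 2) x →L[ℝ] Plane :=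
  mfderiv (𝓡 2) (𝓡 2) φ x

/-- The expression of a vector field in a chart. -/
def rep (φ : OpenPartialHomeomorph M Plane) (X : VField M) (y : Plane) : Plane :=
  dchart φ (φ.symm y) (X (φ.symm y))

/-- A constant vector field on the plane. -/
def constField (w : Plane) (x : Plane) : TangentSpace (𝓡 2) x := w

/-- The vector field with constant coordinates `w` in a chart. -/
def coordField (φ : OpenPartialHomeomorph M Plane) (w : Plane) : VField M :=
  mpullback (𝓡 2) (𝓡 2) φ (constField w)

variable {φ : OpenPartialHomeomorph M Plane}

lemma mdifferentiable_of_mem_maximalAtlas (hφ : φ ∈ IsManifold.maximalAtlas (𝓡 2) ∞ M) :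
    φ.MDifferentiable (𝓡 2) (𝓡 2) :=
  ⟨fun _ hx ↦ ((contMDiffAt_of_mem_maximalAtlas hφ hx).mdifferentiableAt
    (by simp)).mdifferentiableWithinAt,
  fun _ hx ↦ ((contMDiffAt_symm_of_mem_maximalAtlas hφ hx).mdifferentiableAt
    (by simp)).mdifferentiableWithinAt⟩

lemma dchart_isInvertible (hφ : φ ∈ IsManifold.maximalAtlas (𝓡 2) ∞ M) {x : M}
    (hx : x ∈ φ.source) : (mfderiv (𝓡 2) (𝓡 2) φ x).IsInvertible :=
  ⟨(mdifferentiable_of_mem_maximalAtlas hφ).mfderiv hx, rfl⟩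

lemma dchart_injective (hφ : φ ∈ IsManifold.maximalAtlas (𝓡 2) ∞ M) {x : M}
    (hx : x ∈ φ.source) : Function.Injective (dchart φ x) :=
  (mdifferentiable_of_mem_maximalAtlas hφ).mfderiv_injective hx

lemma dchart_coordField (hφ : φ ∈ IsManifold.maximalAtlas (𝓡 2) ∞ M) {x : M}
    (hx : x ∈ φ.source) (w : Plane) : dchart φ x (coordField φ w x) = w :=
  (dchart_isInvertible hφ hx).self_apply_inverse w

lemma rep_apply_chart {x : M} (hx : x ∈ φ.source) (X : VField M) :
    rep φ X (φ x) = dchart φ x (X x) := by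
  rw [rep, φ.left_inv hx]

/-- The inverse of the differential of `φ.symm` is the differential of `φ`; regularity of pullbacks
thereby passes to `rep`. -/
lemma rep_eq_mpullback (hφ : φ ∈ IsManifold.maximalAtlas (𝓡 2) ∞ M) {y : Plane}
    (hy : y ∈ φ.target) (X : VField M) :
    rep φ X y = mpullback (𝓡 2) (𝓡 2) φ.symm X y := by
  have h := mdifferentiable_of_mem_maximalAtlas hφ
  obtain ⟨e, he⟩ : (mfderiv (𝓡 2) (𝓡 2) φ.symm y).IsInvertible := ⟨h.symm.mfderiv hy, rfl⟩
  rw [rep, mpullback_apply]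
  have h1 := h.comp_symm_deriv hy
  rw [← he] at h1 ⊢
  rw [ContinuousLinearMap.inverse_equiv]
  have h2 := congr($h1 (e.symm (X (φ.symm y))))
  have h3 : (mfderiv (𝓡 2) (𝓡 2) φ (φ.symm y)) (e (e.symm (X (φ.symm y)))) =
      e.symm (X (φ.symm y)) := h2
  rw [ContinuousLinearEquiv.apply_symm_apply] at h3
  exact h3

/-- A vector field is smooth on a set. -/
def IsSmoothFieldOn (X : VField M) (u : Set M) : Prop :=
  ContMDiffOn (𝓡 2) (𝓡 2).tangent ∞ (fun x ↦ (⟨x, X x⟩ : TangentBundle (𝓡 2) M)) u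

/-- A vector field is differentiable at a point. -/
def DiffFieldAt (X : VField M) (x : M) : Prop :=
  MDifferentiableAt (𝓡 2) (𝓡 2).tangent (fun x ↦ (⟨x, X x⟩ : TangentBundle (𝓡 2) M)) x

lemma IsSmoothFieldOn.mono {X : VField M} {u v : Set M} (h : IsSmoothFieldOn X u) (hv : v ⊆ u) :
    IsSmoothFieldOn X v := ContMDiffOn.mono h hv

lemma IsSmoothFieldOn.diffFieldAt {X : VField M} {u : Set M} (h : IsSmoothFieldOn X u)
    (hu : IsOpen u) {x : M} (hx : x ∈ u) : DiffFieldAt X x :=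
  ((h x hx).contMDiffAt (hu.mem_nhds hx)).mdifferentiableAt (by simp)

lemma IsSmoothField.isSmoothFieldOn {X : VField M} (h : IsSmoothField X) (u : Set M) :
    IsSmoothFieldOn X u := ContMDiff.contMDiffOn h

lemma isSmoothFieldOn_coordField (hφ : φ ∈ IsManifold.maximalAtlas (𝓡 2) ∞ M) (w : Plane) :
    IsSmoothFieldOn (coordField φ w) φ.source := by
  intro x hx
  refine ContMDiffAt.contMDiffWithinAt ?_
  refine ContMDiffAt.mpullback_vectorField_preimage (n := ∞) ?_
    (contMDiffAt_of_mem_maximalAtlas hφ hx) (dchart_isInvertible hφ hx) (by simp)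
  exact contMDiffAt_vectorSpace_iff_contDiffAt.2 contDiffAt_const

lemma IsSmoothFieldOn.contDiffOn_rep (hφ : φ ∈ IsManifold.maximalAtlas (𝓡 2) ∞ M) {X : VField M}
    {u : Set M} (hu : IsOpen u) (hX : IsSmoothFieldOn X u) :
    ContDiffOn ℝ ∞ (rep φ X) (φ.target ∩ φ.symm ⁻¹' u) := by
  intro y hy
  refine ContDiffAt.contDiffWithinAt ?_
  have h : ContDiffAt ℝ ∞ (mpullback (𝓡 2) (𝓡 2) φ.symm X) y := by
    refine contMDiffAt_vectorSpace_iff_contDiffAt.1 ?_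
    exact ContMDiffAt.mpullback_vectorField_preimage (n := ∞)
      ((hX _ hy.2).contMDiffAt (hu.mem_nhds hy.2)) (contMDiffAt_symm_of_mem_maximalAtlas hφ hy.1)
      ⟨(mdifferentiable_of_mem_maximalAtlas hφ).symm.mfderiv hy.1, rfl⟩ (by simp)
  refine h.congr_of_eventuallyEq ?_
  filter_upwards [φ.open_target.mem_nhds hy.1] with z hz
  exact rep_eq_mpullback hφ hz X

lemma DiffFieldAt.differentiableAt_rep (hφ : φ ∈ IsManifold.maximalAtlas (𝓡 2) ∞ M) {X : VField M}
    {x : M} (hx : x ∈ φ.source) (hX : DiffFieldAt X x) : DifferentiableAt ℝ (rep φ X) (φ x) := by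
  have hy := φ.map_source hx
  have h : MDifferentiableAt (𝓡 2) (𝓡 2).tangent
      (fun y ↦ (⟨y, mpullback (𝓡 2) (𝓡 2) φ.symm X y⟩ : TangentBundle (𝓡 2) Plane)) (φ x) :=
    MDifferentiableAt.mpullback_vectorField (n := ∞) (by rwa [φ.left_inv hx])
      (contMDiffAt_symm_of_mem_maximalAtlas hφ hy)
      ⟨(mdifferentiable_of_mem_maximalAtlas hφ).symm.mfderiv hy, rfl⟩ ENat.LEInfty.out
  have h2 : MDifferentiableAt (𝓡 2) (𝓡 2) (mpullback (𝓡 2) (𝓡 2) φ.symm X) (φ x) :=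
    MDifferentiableAt.comp (φ x) (((contMDiff_snd_tangentBundle_modelSpace Plane (𝓡 2)
      (n := 1)).contMDiffAt).mdifferentiableAt one_ne_zero) h
  refine h2.differentiableAt.congr_of_eventuallyEq ?_
  filter_upwards [φ.open_target.mem_nhds hy] with z hz
  exact rep_eq_mpullback hφ hz X

/-- The standard basis vectors of the plane. -/
def stdVec (i : Fin 2) : Plane := EuclideanSpace.single i 1

lemma sum_smul_stdVec (w : Plane) : ∑ i, w i • stdVec i = w := by
  ext j
  fin_cases j <;> simp [stdVec, Fin.sum_univ_two]

lemma sum_rep_smul_coordField (hφ : φ ∈ IsManifold.maximalAtlas (𝓡 2) ∞ M) {x : M}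
    (hx : x ∈ φ.source) (X : VField M) :
    X x = ∑ k, rep φ X (φ x) k • coordField φ (stdVec k) x := by
  apply dchart_injective hφ hx
  simp only [map_sum, map_smul, dchart_coordField hφ hx, sum_smul_stdVec, rep_apply_chart hx]

/-- Partial derivatives of a function on the plane. -/
def pd (i : Fin 2) (f : Plane → ℝ) (y : Plane) : ℝ := fderiv ℝ f y (stdVec i)

lemma fderiv_apply_eq_sum_pd (f : Plane → ℝ) (y w : Plane) :
    fderiv ℝ f y w = ∑ i, w i * pd i f y := by
  conv_lhs => rw [← sum_smul_stdVec w]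
  simp [pd]

/-- Multiplication by a bump function. Coordinate fields are only smooth on a chart domain, whereas
`IsSmoothField`, and with it `TensorYVanishes`, concerns global fields. -/
lemma exists_isSmoothField_eventuallyEq [T2Space M] {X : VField M} {u : Set M} (hu : IsOpen u)
    (hX : IsSmoothFieldOn X u) {x : M} (hx : x ∈ u) :
    ∃ X' : VField M, IsSmoothField X' ∧ ∀ᶠ z in 𝓝 x, X' z = X z := by
  obtain ⟨f, hf, -⟩ := (SmoothBumpFunction.nhds_basis_support (I := 𝓡 2) (hu.mem_nhds hx)).mem_iff.1
    (Filter.univ_mem : univ ∈ 𝓝 x)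
  refine ⟨(f : M → ℝ) • X, ?_, ?_⟩
  · exact ContMDiffOn.smul_section_of_tsupport (f.contMDiff.contMDiffOn) hu hf hX
  · filter_upwards [f.eventuallyEq_one] with z hz
    simp [hz]

lemma DiffFieldAt.congr {X Y : VField M} {x : M} (h : DiffFieldAt X x)
    (hXY : ∀ᶠ z in 𝓝 x, Y z = X z) : DiffFieldAt Y x := by
  refine MDifferentiableAt.congr_of_eventuallyEq h ?_
  filter_upwards [hXY] with z hz
  rw [hz]

lemma cov_congr (cov : Connection M) {X Y : VField M} {x : M} (h : DiffFieldAt X x)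
    (hXY : ∀ᶠ z in 𝓝 x, Y z = X z) : cov Y x = cov X x :=
  cov.isCovariantDerivativeOnUniv.congr_of_eventuallyEq (h.congr hXY) h Filter.univ_mem hXY

lemma IsSmoothFieldOn.nabla [T2Space M] {cov : Connection M} [cov.ContMDiffCovariantDerivative ∞]
    {X Y : VField M} {u : Set M} (hu : IsOpen u) (hX : IsSmoothFieldOn X u)
    (hY : IsSmoothFieldOn Y u) : IsSmoothFieldOn (nabla cov X Y) u := by
  intro x hx
  refine ContMDiffAt.contMDiffWithinAt ?_
  obtain ⟨Y', hY', heq⟩ := exists_isSmoothField_eventuallyEq hu hY hx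
  have h1 := (CovariantDerivative.ContMDiffCovariantDerivative.contMDiff
    (cov := cov) (k := ∞)).contMDiff (σ := Y') (by simpa using hY'.contMDiffOn)
  have h2 : IsSmoothFieldOn (AffineSurface.nabla cov X Y') u :=
    ContMDiffOn.clm_bundle_apply (h1.mono (subset_univ _)) hX
  refine ((h2 x hx).contMDiffAt (hu.mem_nhds hx)).congr_of_eventuallyEq ?_
  filter_upwards [heq.eventually_nhds, hu.mem_nhds hx] with z hz hzu
  rw [AffineSurface.nabla, AffineSurface.nabla, cov_congr cov (hY.diffFieldAt hu hzu) hz]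

lemma differentiable_constField (w y : Plane) :
    MDifferentiableAt (𝓡 2) (𝓡 2).tangent
      (fun x ↦ (⟨x, constField w x⟩ : TangentBundle (𝓡 2) Plane)) y :=
  ((contMDiffAt_vectorSpace_iff_contDiffAt (n := 1)).2
    (contDiffAt_const (c := w))).mdifferentiableAt one_ne_zero

lemma mlieBracket_constField (v w y : Plane) :
    mlieBracket (𝓡 2) (constField v) (constField w) y = 0 := by
  rw [← mlieBracketWithin_univ, mlieBracketWithin_eq_lieBracketWithin]
  have h : ∀ u a : Plane, fderivWithin ℝ (fun _ : Plane ↦ u) univ y a = 0 := fun u a ↦ by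
    rw [fderivWithin_univ, fderiv_fun_const]
    rfl
  exact (congrArg₂ (· - ·) (h w v) (h v w)).trans (sub_zero (0 : Plane))

/-- The Christoffel symbols of a connection in a chart: `christoffel cov φ k i j` is the `k`-th
coordinate of `∇_{∂_i} ∂_j`. -/
def christoffel (cov : Connection M) (φ : OpenPartialHomeomorph M Plane) (k i j : Fin 2)
    (y : Plane) : ℝ :=
  rep φ (nabla cov (coordField φ (stdVec i)) (coordField φ (stdVec j))) y k

lemma contDiffOn_coord {f : Plane → Plane} {u : Set Plane} (hf : ContDiffOn ℝ ∞ f u) (k : Fin 2) :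
    ContDiffOn ℝ ∞ (fun y ↦ f y k) u :=
  (EuclideanSpace.proj (𝕜 := ℝ) k).contDiff.comp_contDiffOn hf

lemma differentiableAt_coord {f : Plane → Plane} {y : Plane} (hf : DifferentiableAt ℝ f y)
    (k : Fin 2) : DifferentiableAt ℝ (fun y ↦ f y k) y :=
  (EuclideanSpace.proj (𝕜 := ℝ) k).differentiableAt.comp y hf

lemma contDiffOn_christoffel [T2Space M] (cov : Connection M) [cov.ContMDiffCovariantDerivative ∞]
    (hφ : φ ∈ IsManifold.maximalAtlas (𝓡 2) ∞ M) (k i j : Fin 2) :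
    ContDiffOn ℝ ∞ (christoffel cov φ k i j) φ.target := by
  have h := (IsSmoothFieldOn.nabla (cov := cov) φ.open_source
    (isSmoothFieldOn_coordField hφ (stdVec i))
    (isSmoothFieldOn_coordField hφ (stdVec j))).contDiffOn_rep hφ φ.open_source
  exact contDiffOn_coord (h.mono fun y hy ↦ ⟨hy, φ.map_target hy⟩) k

lemma mvfderiv_comp_chart (hφ : φ ∈ IsManifold.maximalAtlas (𝓡 2) ∞ M) {x : M}
    (hx : x ∈ φ.source) {g : Plane → ℝ} (hg : DifferentiableAt ℝ g (φ x))
    (v : TangentSpace (𝓡 2) x) :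
    mvfderiv (𝓡 2) (fun z ↦ g (φ z)) x v = fderiv ℝ g (φ x) (dchart φ x v) := by
  have h := mvfderiv_comp_apply (I := 𝓡 2) (I' := 𝓡 2) (g := g) (f := φ) x
    hg.mdifferentiableAt ((mdifferentiable_of_mem_maximalAtlas hφ).mdifferentiableAt hx) v
  have h2 : mvfderiv (𝓡 2) g (φ x) = fderiv ℝ g (φ x) := by
    rw [mvfderiv, mfderiv_eq_fderiv]
    rfl
  rw [h2] at h
  exact h

lemma mdifferentiableAt_comp_chart (hφ : φ ∈ IsManifold.maximalAtlas (𝓡 2) ∞ M) {x : M}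
    (hx : x ∈ φ.source) {g : Plane → ℝ} (hg : DifferentiableAt ℝ g (φ x)) :
    MDifferentiableAt (𝓡 2) 𝓘(ℝ, ℝ) (fun z ↦ g (φ z)) x :=
  hg.mdifferentiableAt.comp x ((mdifferentiable_of_mem_maximalAtlas hφ).mdifferentiableAt hx)

lemma dchart_cov_coordField (cov : Connection M) (hφ : φ ∈ IsManifold.maximalAtlas (𝓡 2) ∞ M)
    {x : M} (hx : x ∈ φ.source) (v : TangentSpace (𝓡 2) x) (l k : Fin 2) :
    dchart φ x (cov (coordField φ (stdVec k)) x v) l =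
      ∑ i, dchart φ x v i * christoffel cov φ l i k (φ x) := by
  have hv : v = ∑ i, dchart φ x v i • coordField φ (stdVec i) x := by
    apply dchart_injective hφ hx
    simp only [map_sum, map_smul, dchart_coordField hφ hx, sum_smul_stdVec]
  conv_lhs => rw [hv]
  simp only [map_sum, map_smul, christoffel, rep_apply_chart hx, nabla, WithLp.ofLp_sum,
    Finset.sum_apply, PiLp.smul_apply, smul_eq_mul]

/-- The covariant derivative in a chart. -/
theorem dchart_cov (cov : Connection M) (hφ : φ ∈ IsManifold.maximalAtlas (𝓡 2) ∞ M) {x : M}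
    (hx : x ∈ φ.source) {Z : VField M} (hZ : DiffFieldAt Z x) (v : TangentSpace (𝓡 2) x)
    (l : Fin 2) :
    dchart φ x (cov Z x v) l = ∑ i, dchart φ x v i * (pd i (fun y ↦ rep φ Z y l) (φ x) +
      ∑ k, christoffel cov φ l i k (φ x) * rep φ Z (φ x) k) := by
  have hdZ := fun k ↦ differentiableAt_coord (hZ.differentiableAt_rep hφ hx) k
  set z : Fin 2 → M → ℝ := fun k x ↦ rep φ Z (φ x) k with hz
  have hzd : ∀ k, MDifferentiableAt (𝓡 2) 𝓘(ℝ, ℝ) (z k) x := fun k ↦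
    mdifferentiableAt_comp_chart hφ hx (hdZ k)
  have hE : ∀ k, DiffFieldAt (coordField φ (stdVec k)) x := fun k ↦
    (isSmoothFieldOn_coordField hφ (stdVec k)).diffFieldAt φ.open_source hx
  have hzE : ∀ k, DiffFieldAt (z k • coordField φ (stdVec k)) x := fun k ↦
    (hzd k).smul_section (hE k)
  -- Near `x` the field is a combination of coordinate fields, to which locality and the Leibniz
  -- rule apply.
  have heq : ∀ᶠ w in 𝓝 x, (z 0 • coordField φ (stdVec 0) + z 1 • coordField φ (stdVec 1)) w
      = Z w := by
    filter_upwards [φ.open_source.mem_nhds hx] with w hw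
    rw [sum_rep_smul_coordField hφ hw Z, Fin.sum_univ_two]
    rfl
  rw [← cov_congr cov hZ heq, cov.isCovariantDerivativeOnUniv.add (hzE 0) (hzE 1),
    cov.isCovariantDerivativeOnUniv.leibniz (hE 0) (hzd 0),
    cov.isCovariantDerivativeOnUniv.leibniz (hE 1) (hzd 1)]
  have hmv : ∀ k, mvfderiv (𝓡 2) (z k) x v =
      ∑ i, dchart φ x v i * pd i (fun y ↦ rep φ Z y k) (φ x) := fun k ↦ by
    rw [← fderiv_apply_eq_sum_pd]
    exact mvfderiv_comp_chart hφ hx (hdZ k) v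
  simp only [add_apply, smul_apply, ContinuousLinearMap.smulRight_apply, map_add, map_smul,
    PiLp.add_apply, PiLp.smul_apply, smul_eq_mul, dchart_cov_coordField cov hφ hx,
    dchart_coordField hφ hx, hmv]
  fin_cases l <;> simp [hz, stdVec, Fin.sum_univ_two] <;> ring

lemma rep_nabla (cov : Connection M) (hφ : φ ∈ IsManifold.maximalAtlas (𝓡 2) ∞ M) {y : Plane}
    (hy : y ∈ φ.target) (X : VField M) {Z : VField M} (hZ : DiffFieldAt Z (φ.symm y)) (l : Fin 2) :
    rep φ (nabla cov X Z) y l = ∑ i, rep φ X y i * (pd i (fun y ↦ rep φ Z y l) y +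
      ∑ k, christoffel cov φ l i k y * rep φ Z y k) := by
  have h := dchart_cov cov hφ (φ.map_target hy) hZ (X (φ.symm y)) l
  rw [φ.right_inv hy] at h
  exact h

/-- Coordinate fields commute, being pullbacks of constant fields, so vanishing torsion gives
`∇_{∂_i} ∂_j = ∇_{∂_j} ∂_i`. -/
lemma christoffel_symm {cov : Connection M} (htor : cov.torsion = 0)
    (hφ : φ ∈ IsManifold.maximalAtlas (𝓡 2) ∞ M) {y : Plane} (hy : y ∈ φ.target)
    (k i j : Fin 2) : christoffel cov φ k i j y = christoffel cov φ k j i y := by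
  have : IsManifold (𝓡 2) (minSmoothness ℝ 2) M := by
    rw [minSmoothness_of_isRCLikeNormedField]
    infer_instance
  have : IsManifold (𝓡 2) (minSmoothness ℝ 2) Plane := by
    rw [minSmoothness_of_isRCLikeNormedField]
    infer_instance
  have hx := φ.map_target hy
  have hE : ∀ k, DiffFieldAt (coordField φ (stdVec k)) (φ.symm y) := fun k ↦
    (isSmoothFieldOn_coordField hφ (stdVec k)).diffFieldAt φ.open_source hx
  have h := (cov.torsion_eq_zero_iff.1 htor) (hE i) (hE j)
  have hb : mlieBracket (𝓡 2) (coordField φ (stdVec i)) (coordField φ (stdVec j)) (φ.symm y) = 0 := by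
    rw [coordField, coordField, ← mpullback_mlieBracket (n := ∞)
      (differentiable_constField _ _)
      (differentiable_constField _ _)
      (contMDiffAt_of_mem_maximalAtlas hφ hx) (by simp; exact ENat.LEInfty.out)]
    exact (congrArg _ (mlieBracket_constField (stdVec i) (stdVec j) _)).trans (map_zero _)
  rw [hb, sub_eq_zero] at h
  rw [christoffel, christoffel, rep, rep, nabla, nabla, h]

end ChartExpressions

/-! ### Curvature and Ricci tensor in a chart. -/

section Curvature

section PartialDerivatives

variable {f g : Plane → ℝ} {y : Plane}

lemma pd_add (hf : DifferentiableAt ℝ f y) (hg : DifferentiableAt ℝ g y) (i : Fin 2) :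
    pd i (fun z ↦ f z + g z) y = pd i f y + pd i g y := by
  rw [pd, fderiv_fun_add hf hg]
  rfl

lemma pd_mul (hf : DifferentiableAt ℝ f y) (hg : DifferentiableAt ℝ g y) (i : Fin 2) :
    pd i (fun z ↦ f z * g z) y = pd i f y * g y + f y * pd i g y := by
  rw [pd, fderiv_fun_mul hf hg]
  simp [pd]
  ring

lemma pd_congr (h : f =ᶠ[𝓝 y] g) (i : Fin 2) : pd i f y = pd i g y := by
  rw [pd, h.fderiv_eq, pd]

lemma contDiffOn_pd {u : Set Plane} (hu : IsOpen u) (hf : ContDiffOn ℝ ∞ f u) (i : Fin 2) :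
    ContDiffOn ℝ ∞ (pd i f) u :=
  (hf.fderiv_of_isOpen hu (by simp)).clm_apply contDiffOn_const

lemma _root_.ContDiffOn.differentiableAt_of_isOpen {E : Type*} [NormedAddCommGroup E] [NormedSpace ℝ E]
    {h : Plane → E} {u : Set Plane} (hf : ContDiffOn ℝ ∞ h u) (hu : IsOpen u) (hy : y ∈ u) :
    DifferentiableAt ℝ h y :=
  (hf.contDiffAt (hu.mem_nhds hy)).differentiableAt (by simp)

lemma pd_comm {u : Set Plane} (hu : IsOpen u) (hf : ContDiffOn ℝ ∞ f u) (hy : y ∈ u)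
    (i j : Fin 2) : pd i (pd j f) y = pd j (pd i f) y := by
  have hd : DifferentiableAt ℝ (fderiv ℝ f) y :=
    ((hf.fderiv_of_isOpen hu (m := ∞) (by simp)).contDiffAt (hu.mem_nhds hy)).differentiableAt
      (by simp)
  have key : ∀ i j, pd i (pd j f) y = fderiv ℝ (fderiv ℝ f) y (stdVec i) (stdVec j) := by
    intro i j
    have h : HasFDerivAt (pd j f) _ y :=
      (ContinuousLinearMap.apply ℝ ℝ (stdVec j)).hasFDerivAt.comp y hd.hasFDerivAt
    rw [pd, h.fderiv]
    rfl
  rw [key, key]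
  exact (hf.contDiffAt (hu.mem_nhds hy)).isSymmSndFDerivAt
    (by rw [minSmoothness_of_isRCLikeNormedField]; exact ENat.LEInfty.out) _ _

end PartialDerivatives

section LocalTensors

/-- A system of Christoffel symbols on the plane; `Γ k i j` is the `k`-th coordinate of
`∇_{∂_i} ∂_j`. -/
abbrev Symbols : Type := Fin 2 → Fin 2 → Fin 2 → Plane → ℝ

/-- The `l`-th coordinate of `R(∂_i, ∂_j) ∂_k`. -/
def riem (Γ : Symbols) (l i j k : Fin 2) (y : Plane) : ℝ :=
  pd i (Γ l j k) y - pd j (Γ l i k) y + ∑ m, (Γ l i m y * Γ m j k y - Γ l j m y * Γ m i k y)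

/-- The coordinates of the Ricci tensor. -/
def ric (Γ : Symbols) (j k : Fin 2) (y : Plane) : ℝ := ∑ i, riem Γ i i j k y

/-- The coordinates of `∇_a R_bc - ∇_b R_ac`. -/
def cotton (Γ : Symbols) (i j k : Fin 2) (y : Plane) : ℝ :=
  pd i (ric Γ j k) y - pd j (ric Γ i k) y - ∑ m, ric Γ j m y * Γ m i k y
    + ∑ m, ric Γ i m y * Γ m j k y

variable {Γ : Symbols} {u : Set Plane}

lemma contDiffOn_riem (hu : IsOpen u) (hΓ : ∀ k i j, ContDiffOn ℝ ∞ (Γ k i j) u) (l i j k : Fin 2) :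
    ContDiffOn ℝ ∞ (riem Γ l i j k) u :=
  ((contDiffOn_pd hu (hΓ l j k) i).sub (contDiffOn_pd hu (hΓ l i k) j)).add
    (ContDiffOn.sum fun m _ ↦ ((hΓ l i m).mul (hΓ m j k)).sub ((hΓ l j m).mul (hΓ m i k)))

lemma contDiffOn_ric (hu : IsOpen u) (hΓ : ∀ k i j, ContDiffOn ℝ ∞ (Γ k i j) u) (j k : Fin 2) :
    ContDiffOn ℝ ∞ (ric Γ j k) u :=
  ContDiffOn.sum fun i _ ↦ contDiffOn_riem hu hΓ i i j k

/-- The `l`-th coordinate of `∇_X Z` in terms of the coordinates of `X` and `Z`. -/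
def symbolsNabla (Γ : Symbols) (X Z : Plane → Plane) (l : Fin 2) (y : Plane) : ℝ :=
  ∑ i, X y i * (pd i (fun y ↦ Z y l) y + ∑ k, Γ l i k y * Z y k)

lemma pd_symbolsNabla (hu : IsOpen u) (hΓ : ∀ k i j, ContDiffOn ℝ ∞ (Γ k i j) u)
    {Y Z : Plane → Plane} (hY : ContDiffOn ℝ ∞ Y u) (hZ : ContDiffOn ℝ ∞ Z u) {y : Plane}
    (hy : y ∈ u) (i l : Fin 2) :
    pd i (symbolsNabla Γ Y Z l) y = ∑ j, (pd i (fun y ↦ Y y j) y *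
      (pd j (fun y ↦ Z y l) y + ∑ k, Γ l j k y * Z y k) +
      Y y j * (pd i (pd j (fun y ↦ Z y l)) y +
        ∑ k, (pd i (Γ l j k) y * Z y k + Γ l j k y * pd i (fun y ↦ Z y k) y))) := by
  have dY : ∀ j, DifferentiableAt ℝ (fun y ↦ Y y j) y := fun j ↦
    (contDiffOn_coord hY j).differentiableAt_of_isOpen hu hy
  have dZ : ∀ j, DifferentiableAt ℝ (fun y ↦ Z y j) y := fun j ↦
    (contDiffOn_coord hZ j).differentiableAt_of_isOpen hu hy
  have dpZ : ∀ j, DifferentiableAt ℝ (pd j (fun y ↦ Z y l)) y := fun j ↦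
    (contDiffOn_pd hu (contDiffOn_coord hZ l) j).differentiableAt_of_isOpen hu hy
  have dΓ : ∀ j k, DifferentiableAt ℝ (Γ l j k) y := fun j k ↦
    (hΓ l j k).differentiableAt_of_isOpen hu hy
  have e1 : ∀ j k, DifferentiableAt ℝ (fun y ↦ Γ l j k y * Z y k) y := fun j k ↦
    (dΓ j k).mul (dZ k)
  have e2 : ∀ j, DifferentiableAt ℝ (fun y ↦ Γ l j 0 y * Z y 0 + Γ l j 1 y * Z y 1) y := fun j ↦
    (e1 j 0).add (e1 j 1)
  have e3 : ∀ j, DifferentiableAt ℝ (fun y ↦ pd j (fun y ↦ Z y l) y +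
      (Γ l j 0 y * Z y 0 + Γ l j 1 y * Z y 1)) y := fun j ↦ (dpZ j).add (e2 j)
  have e4 : ∀ j, DifferentiableAt ℝ (fun y ↦ Y y j * (pd j (fun y ↦ Z y l) y +
      (Γ l j 0 y * Z y 0 + Γ l j 1 y * Z y 1))) y := fun j ↦ (dY j).mul (e3 j)
  have hs : symbolsNabla Γ Y Z l = fun y ↦ Y y 0 * (pd 0 (fun y ↦ Z y l) y +
      (Γ l 0 0 y * Z y 0 + Γ l 0 1 y * Z y 1)) + Y y 1 * (pd 1 (fun y ↦ Z y l) y +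
      (Γ l 1 0 y * Z y 0 + Γ l 1 1 y * Z y 1)) := by
    funext y
    simp only [symbolsNabla, Fin.sum_univ_two]
  rw [hs, pd_add (e4 0) (e4 1), pd_mul (dY 0) (e3 0), pd_mul (dY 1) (e3 1),
    pd_add (dpZ 0) (e2 0), pd_add (dpZ 1) (e2 1), pd_add (e1 0 0) (e1 0 1),
    pd_add (e1 1 0) (e1 1 1), pd_mul (dΓ 0 0) (dZ 0), pd_mul (dΓ 0 1) (dZ 1),
    pd_mul (dΓ 1 0) (dZ 0), pd_mul (dΓ 1 1) (dZ 1)]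
  simp only [Fin.sum_univ_two]

end LocalTensors

variable {M : Type*} [TopologicalSpace M] [T2Space M] [ChartedSpace Plane M]
  [IsManifold (𝓡 2) ∞ M] {φ : OpenPartialHomeomorph M Plane}
  {cov : Connection M} [cov.ContMDiffCovariantDerivative ∞]

lemma isOpen_target_inter {v : Set M} (hv : IsOpen v) : IsOpen (φ.target ∩ φ.symm ⁻¹' v) :=
  φ.isOpen_inter_preimage_symm hv

lemma rep_nabla_eqOn (hφ : φ ∈ IsManifold.maximalAtlas (𝓡 2) ∞ M) {v : Set M} (hv : IsOpen v)
    (X : VField M) {Z : VField M} (hZ : IsSmoothFieldOn Z v) (l : Fin 2) :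
    ∀ y ∈ φ.target ∩ φ.symm ⁻¹' v, rep φ (nabla cov X Z) y l =
      symbolsNabla (christoffel cov φ) (rep φ X) (rep φ Z) l y :=
  fun _ hy ↦ rep_nabla cov hφ hy.1 X (hZ.diffFieldAt hv hy.2) l

/-- The curvature in a chart. -/
theorem rep_curvature (htor : cov.torsion = 0) (hφ : φ ∈ IsManifold.maximalAtlas (𝓡 2) ∞ M)
    {v : Set M} (hv : IsOpen v) {X Y Z : VField M} (hX : IsSmoothFieldOn X v)
    (hY : IsSmoothFieldOn Y v) (hZ : IsSmoothFieldOn Z v) {y : Plane} (hy : y ∈ φ.target)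
    (hyv : φ.symm y ∈ v) (l : Fin 2) :
    rep φ (curvature cov X Y Z) y l = ∑ i, ∑ j, ∑ k, rep φ X y i * rep φ Y y j * rep φ Z y k *
      riem (christoffel cov φ) l i j k y := by
  set Γ := christoffel cov φ with hΓdef
  set u := φ.target ∩ φ.symm ⁻¹' v with hu
  have huo : IsOpen u := isOpen_target_inter hv
  have hyu : y ∈ u := ⟨hy, hyv⟩
  have hΓ : ∀ k i j, ContDiffOn ℝ ∞ (Γ k i j) u := fun k i j ↦
    (contDiffOn_christoffel cov hφ k i j).mono inter_subset_left
  have cX := hX.contDiffOn_rep hφ hv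
  have cY := hY.contDiffOn_rep hφ hv
  have cZ := hZ.contDiffOn_rep hφ hv
  have sYZ : IsSmoothFieldOn (nabla cov Y Z) v := hY.nabla hv hZ
  have sXZ : IsSmoothFieldOn (nabla cov X Z) v := hX.nabla hv hZ
  have hev : ∀ W : VField M, (fun z ↦ rep φ (nabla cov W Z) z l) =ᶠ[𝓝 y]
      symbolsNabla Γ (rep φ W) (rep φ Z) l := fun W ↦ by
    filter_upwards [huo.mem_nhds hyu] with z hz
    exact rep_nabla_eqOn hφ hv W hZ l z hz
  -- Vanishing torsion trades the bracket for covariant derivatives, so `rep_nabla` covers every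
  -- term.
  have hbr : mlieBracket (𝓡 2) X Y (φ.symm y) =
      nabla cov X Y (φ.symm y) - nabla cov Y X (φ.symm y) :=
    ((cov.torsion_eq_zero_iff.1 htor) (hX.diffFieldAt hv hyv) (hY.diffFieldAt hv hyv)).symm
  have hsplit : rep φ (curvature cov X Y Z) y l = rep φ (nabla cov X (nabla cov Y Z)) y l -
      rep φ (nabla cov Y (nabla cov X Z)) y l -
      (rep φ (nabla cov (nabla cov X Y) Z) y l - rep φ (nabla cov (nabla cov Y X) Z) y l) := by
    simp only [rep, curvature, map_sub, PiLp.sub_apply]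
    congr 1
    rw [nabla, hbr, map_sub, map_sub, PiLp.sub_apply]
    rfl
  rw [hsplit, rep_nabla cov hφ hy X (sYZ.diffFieldAt hv hyv),
    rep_nabla cov hφ hy Y (sXZ.diffFieldAt hv hyv),
    rep_nabla cov hφ hy (nabla cov X Y) (hZ.diffFieldAt hv hyv),
    rep_nabla cov hφ hy (nabla cov Y X) (hZ.diffFieldAt hv hyv)]
  simp only [pd_congr (hev Y), pd_congr (hev X), pd_symbolsNabla huo hΓ cY cZ hyu,
    pd_symbolsNabla huo hΓ cX cZ hyu, rep_nabla cov hφ hy _ (hZ.diffFieldAt hv hyv),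
    rep_nabla cov hφ hy _ (hX.diffFieldAt hv hyv), rep_nabla cov hφ hy _ (hY.diffFieldAt hv hyv),
    ← hΓdef, riem, Fin.sum_univ_two]
  have hs : ∀ k, Γ k 1 0 y = Γ k 0 1 y := fun k ↦ christoffel_symm htor hφ hy k 1 0
  simp only [hs]
  rw [pd_comm huo (contDiffOn_coord cZ l) hyu 1 0]
  ring

lemma exists_isSmoothFieldOn_extend {x : M} (v : TangentSpace (𝓡 2) x) :
    ∃ u, IsOpen u ∧ x ∈ u ∧
      IsSmoothFieldOn (extend Plane v : VField M) u := by
  obtain ⟨s, hs, hsm⟩ := exists_contMDiffOn_extend (k := ∞) (𝓡 2) Plane v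
  exact ⟨interior s, isOpen_interior, mem_interior_iff_mem_nhds.2 hs,
    hsm.mono interior_subset⟩

/-- Conjugate endomorphisms have the same trace. This moves the trace defining `ricci` from
`tangentBasis` to the coordinates of an arbitrary chart. -/
lemma sum_coord_conj_eq_sum {V : Type*} [AddCommGroup V] [Module ℝ V]
    (b : Module.Basis (Fin 2) ℝ V) (e : V ≃ₗ[ℝ] Plane) (S : Plane →ₗ[ℝ] Plane) :
    ∑ i, b.coord i (e.symm (S (e (b i)))) = ∑ l, S (stdVec l) l := by
  have h1 : LinearMap.trace ℝ V (e.symm.conj S) = ∑ i, b.coord i (e.symm (S (e (b i)))) := by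
    rw [LinearMap.trace_eq_matrix_trace ℝ b, Matrix.trace]
    simp [LinearMap.toMatrix_apply, LinearEquiv.conj_apply]
  have h2 : LinearMap.trace ℝ Plane S = ∑ l, S (stdVec l) l := by
    rw [LinearMap.trace_eq_matrix_trace ℝ (EuclideanSpace.basisFun (Fin 2) ℝ).toBasis, Matrix.trace]
    simp [LinearMap.toMatrix_apply, stdVec]
  rw [← h1, ← h2, LinearMap.trace_conj']

/-- The Ricci tensor in a chart. -/
theorem ricci_eq (htor : cov.torsion = 0) (hφ : φ ∈ IsManifold.maximalAtlas (𝓡 2) ∞ M)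
    {v : Set M} (hv : IsOpen v) {Y Z : VField M}
    (hY : IsSmoothFieldOn Y v) (hZ : IsSmoothFieldOn Z v) {x : M} (hx : x ∈ φ.source)
    (hxv : x ∈ v) :
    ricci cov Y Z x = ∑ j, ∑ k, ric (christoffel cov φ) j k (φ x) *
      (rep φ Y (φ x) j * rep φ Z (φ x) k) := by
  let e : TangentSpace (𝓡 2) x ≃ₗ[ℝ] Plane :=
    ((mdifferentiable_of_mem_maximalAtlas hφ).mfderiv hx).toLinearEquiv
  have he : ∀ w, e w = dchart φ x w := fun w ↦ rfl
  -- The map `V ↦ R(V, Y) Z` in coordinates. It is written as a linear map because linearity is not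
  -- visible in the definition through `extend`.
  let S : Plane →ₗ[ℝ] Plane :=
    { toFun := fun w ↦ WithLp.toLp 2 fun l ↦ ∑ i, ∑ j, ∑ k, w i * rep φ Y (φ x) j *
        rep φ Z (φ x) k * riem (christoffel cov φ) l i j k (φ x)
      map_add' := fun a b ↦ by
        ext l
        simp [Fin.sum_univ_two]
        ring
      map_smul' := fun c a ↦ by
        ext l
        simp [Fin.sum_univ_two]
        ring }
  have hcurv : ∀ w : TangentSpace (𝓡 2) x,
      curvature cov (extend Plane w) Y Z x = e.symm (S (e w)) := by
    intro w
    rw [LinearEquiv.eq_symm_apply]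
    obtain ⟨u, hu, hxu, hsm⟩ := exists_isSmoothFieldOn_extend w
    have h := rep_curvature htor hφ (hu.inter hv) (hsm.mono inter_subset_left)
      (hY.mono inter_subset_right) (hZ.mono inter_subset_right) (φ.map_source hx)
      (by rw [φ.left_inv hx]; exact ⟨hxu, hxv⟩)
    ext l
    have h' := h l
    rw [rep_apply_chart hx, rep_apply_chart hx (X := extend Plane w), extend_apply_self] at h'
    rw [he, h']
    rfl
  have htr := sum_coord_conj_eq_sum (tangentBasis x) e S
  simp only [ricci, hcurv]
  rw [htr]
  simp [S, ric, Fin.sum_univ_two, stdVec]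
  ring

end Curvature

/-! ### The tensor `Y_abc` in a chart. -/

section CottonTensor

variable {M : Type*} [TopologicalSpace M] [T2Space M] [ChartedSpace Plane M]
  [IsManifold (𝓡 2) ∞ M] {φ : OpenPartialHomeomorph M Plane}
  {cov : Connection M} [cov.ContMDiffCovariantDerivative ∞]

lemma pd_sum_sum_mul {y : Plane} {R : Fin 2 → Fin 2 → Plane → ℝ} {a b : Fin 2 → Plane → ℝ}
    (hR : ∀ j k, DifferentiableAt ℝ (R j k) y) (ha : ∀ j, DifferentiableAt ℝ (a j) y)
    (hb : ∀ j, DifferentiableAt ℝ (b j) y) (i : Fin 2) :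
    pd i (fun z ↦ ∑ j, ∑ k, R j k z * (a j z * b k z)) y = ∑ j, ∑ k, (pd i (R j k) y *
      (a j y * b k y) + R j k y * (pd i (a j) y * b k y + a j y * pd i (b k) y)) := by
  have e1 : ∀ j k, DifferentiableAt ℝ (fun z ↦ a j z * b k z) y := fun j k ↦ (ha j).mul (hb k)
  have e2 : ∀ j k, DifferentiableAt ℝ (fun z ↦ R j k z * (a j z * b k z)) y := fun j k ↦
    (hR j k).mul (e1 j k)
  have e3 : ∀ j, DifferentiableAt ℝ (fun z ↦ R j 0 z * (a j z * b 0 z) +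
      R j 1 z * (a j z * b 1 z)) y := fun j ↦ (e2 j 0).add (e2 j 1)
  simp only [Fin.sum_univ_two]
  rw [pd_add (e3 0) (e3 1), pd_add (e2 0 0) (e2 0 1),
    pd_add (e2 1 0) (e2 1 1)]
  simp only [pd_mul (hR _ _) (e1 _ _), pd_mul (ha _) (hb _)]

/-- The covariant derivative of the Ricci tensor in a chart. -/
theorem nablaRicci_eq (htor : cov.torsion = 0) (hφ : φ ∈ IsManifold.maximalAtlas (𝓡 2) ∞ M)
    {v : Set M} (hv : IsOpen v) {X Y Z : VField M} (hX : IsSmoothFieldOn X v)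
    (hY : IsSmoothFieldOn Y v) (hZ : IsSmoothFieldOn Z v) {x : M} (hx : x ∈ φ.source)
    (hxv : x ∈ v) :
    nablaRicci cov X Y Z x = ∑ i, ∑ j, ∑ k, rep φ X (φ x) i * rep φ Y (φ x) j * rep φ Z (φ x) k *
      (pd i (ric (christoffel cov φ) j k) (φ x) -
        ∑ m, ric (christoffel cov φ) m k (φ x) * christoffel cov φ m i j (φ x) -
        ∑ m, ric (christoffel cov φ) j m (φ x) * christoffel cov φ m i k (φ x)) := by
  set Γ := christoffel cov φ with hΓdef
  have hy := φ.map_source hx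
  have hyu : φ x ∈ φ.target ∩ φ.symm ⁻¹' v := ⟨hy, by rwa [mem_preimage, φ.left_inv hx]⟩
  have huo : IsOpen (φ.target ∩ φ.symm ⁻¹' v) := isOpen_target_inter hv
  have dY : ∀ j, DifferentiableAt ℝ (fun y ↦ rep φ Y y j) (φ x) := fun j ↦
    (contDiffOn_coord (hY.contDiffOn_rep hφ hv) j).differentiableAt_of_isOpen huo hyu
  have dZ : ∀ j, DifferentiableAt ℝ (fun y ↦ rep φ Z y j) (φ x) := fun j ↦
    (contDiffOn_coord (hZ.contDiffOn_rep hφ hv) j).differentiableAt_of_isOpen huo hyu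
  have dR : ∀ j k, DifferentiableAt ℝ (ric Γ j k) (φ x) := fun j k ↦
    (contDiffOn_ric φ.open_target (contDiffOn_christoffel cov hφ) j
      k).differentiableAt_of_isOpen φ.open_target hy
  set g : Plane → ℝ := fun y ↦ ∑ j, ∑ k, ric Γ j k y * (rep φ Y y j * rep φ Z y k) with hg
  have dg : DifferentiableAt ℝ g (φ x) :=
    DifferentiableAt.fun_sum fun j _ ↦ DifferentiableAt.fun_sum fun k _ ↦
      (dR j k).mul ((dY j).mul (dZ k))
  have hev : ricci cov Y Z =ᶠ[𝓝 x] fun z ↦ g (φ z) := by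
    filter_upwards [φ.open_source.mem_nhds hx, hv.mem_nhds hxv] with z hz hzv
    exact ricci_eq htor hφ hv hY hZ hz hzv
  have hm : mvfderiv (𝓡 2) (ricci cov Y Z) x (X x) = mvfderiv (𝓡 2) (fun z ↦ g (φ z)) x (X x) := by
    rw [mvfderiv, mvfderiv, hev.mfderiv_eq]
    rfl
  have hn : ∀ {W : VField M}, IsSmoothFieldOn W v → ∀ l, rep φ (nabla cov X W) (φ x) l = 
      ∑ i, rep φ X (φ x) i * (pd i (fun y ↦ rep φ W y l) (φ x) +
        ∑ k, Γ l i k (φ x) * rep φ W (φ x) k) := fun hW l ↦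
    rep_nabla cov hφ hy X (hW.diffFieldAt hv hyu.2) l
  have hpg : ∀ i, pd i g (φ x) = _ := fun i ↦ pd_sum_sum_mul dR dY dZ i
  rw [nablaRicci, hm, mvfderiv_comp_chart hφ hx dg, ← rep_apply_chart hx, fderiv_apply_eq_sum_pd,
    ricci_eq htor hφ hv (hX.nabla hv hY) hZ hx hxv, ricci_eq htor hφ hv hY (hX.nabla hv hZ) hx hxv]
  simp only [hpg, hn hY, hn hZ, ← hΓdef, Fin.sum_univ_two]
  ring

/-- The tensor `Y_abc` in a chart. -/
theorem tensorY_eq (htor : cov.torsion = 0) (hφ : φ ∈ IsManifold.maximalAtlas (𝓡 2) ∞ M)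
    {v : Set M} (hv : IsOpen v) {X Y Z : VField M} (hX : IsSmoothFieldOn X v)
    (hY : IsSmoothFieldOn Y v) (hZ : IsSmoothFieldOn Z v) {x : M} (hx : x ∈ φ.source)
    (hxv : x ∈ v) :
    tensorY cov X Y Z x = ∑ i, ∑ j, ∑ k, rep φ X (φ x) i * rep φ Y (φ x) j * rep φ Z (φ x) k *
      cotton (christoffel cov φ) i j k (φ x) := by
  -- The terms `R_mk Γ^m_ij` are symmetric in `i`, `j` and cancel in the antisymmetrisation, so
  -- `cotton` does not contain them.
  have hs : ∀ k, christoffel cov φ k 1 0 (φ x) = christoffel cov φ k 0 1 (φ x) := fun k ↦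
    christoffel_symm htor hφ (φ.map_source hx) k 1 0
  rw [tensorY, nablaRicci_eq htor hφ hv hX hY hZ hx hxv, nablaRicci_eq htor hφ hv hY hX hZ hx hxv]
  simp only [cotton, Fin.sum_univ_two, hs]
  ring

lemma exists_smooth_rep_eq (hφ : φ ∈ IsManifold.maximalAtlas (𝓡 2) ∞ M) {x : M}
    (hx : x ∈ φ.source) (i : Fin 2) :
    ∃ X : VField M, IsSmoothField X ∧ rep φ X (φ x) = stdVec i := by
  obtain ⟨X, hX, he⟩ := exists_isSmoothField_eventuallyEq φ.open_source
    (isSmoothFieldOn_coordField hφ (stdVec i)) hx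
  refine ⟨X, hX, ?_⟩
  rw [rep_apply_chart hx, he.self_of_nhds, dchart_coordField hφ hx]

/-- The tensor `Y_abc` vanishes if and only if its components in charts do. -/
theorem tensorYVanishes_iff (htor : cov.torsion = 0) (A : M → OpenPartialHomeomorph M Plane)
    (hA : ∀ x, A x ∈ IsManifold.maximalAtlas (𝓡 2) ∞ M) (hxA : ∀ x, x ∈ (A x).source) :
    TensorYVanishes cov ↔ ∀ x i j k, cotton (christoffel cov (A x)) i j k (A x x) = 0 := by
  constructor
  · intro h x i j k
    obtain ⟨X, hX, hX'⟩ := exists_smooth_rep_eq (hA x) (hxA x) i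
    obtain ⟨Y, hY, hY'⟩ := exists_smooth_rep_eq (hA x) (hxA x) j
    obtain ⟨Z, hZ, hZ'⟩ := exists_smooth_rep_eq (hA x) (hxA x) k
    have h1 := h X Y Z hX hY hZ x
    rw [tensorY_eq htor (hA x) isOpen_univ (hX.isSmoothFieldOn _) (hY.isSmoothFieldOn _)
      (hZ.isSmoothFieldOn _) (hxA x) (mem_univ x), hX', hY', hZ'] at h1
    simpa [stdVec, Pi.single_apply] using h1
  · intro h X Y Z hX hY hZ x
    rw [tensorY_eq htor (hA x) isOpen_univ (hX.isSmoothFieldOn _) (hY.isSmoothFieldOn _)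
      (hZ.isSmoothFieldOn _) (hxA x) (mem_univ x)]
    simp [h]

lemma cotton_eq_zero_of_tensorYVanishes (htor : cov.torsion = 0)
    (hφ : φ ∈ IsManifold.maximalAtlas (𝓡 2) ∞ M) (h : TensorYVanishes cov) {y : Plane}
    (hy : y ∈ φ.target) (i j k : Fin 2) : cotton (christoffel cov φ) i j k y = 0 := by
  classical
  -- An assignment of charts that uses `φ` wherever possible transfers the pointwise criterion to
  -- every point of its target.
  let A : M → OpenPartialHomeomorph M Plane := fun x ↦ if x ∈ φ.source then φ else chartAt Plane x
  have hx := φ.map_target hy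
  have := (tensorYVanishes_iff htor A (fun x ↦ by
    by_cases hx : x ∈ φ.source
    · simpa [A, hx] using hφ
    · simpa [A, hx] using IsManifold.chart_mem_maximalAtlas x) (fun x ↦ by
    by_cases hx : x ∈ φ.source
    · simp [A, hx]
    · simp [A, hx])).1 h (φ.symm y) i j k
  simpa [A, hx, φ.right_inv hy] using this

lemma ric_symm (htor : cov.torsion = 0) (hφ : φ ∈ IsManifold.maximalAtlas (𝓡 2) ∞ M)
    (hsymm : HasSymmetricRicci cov) {y : Plane} (hy : y ∈ φ.target) (j k : Fin 2) :
    ric (christoffel cov φ) j k y = ric (christoffel cov φ) k j y := by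
  have hx := φ.map_target hy
  obtain ⟨Y, hY, hY'⟩ := exists_smooth_rep_eq hφ hx j
  obtain ⟨Z, hZ, hZ'⟩ := exists_smooth_rep_eq hφ hx k
  have h := congrFun (hsymm Y Z hY hZ) (φ.symm y)
  rw [ricci_eq htor hφ isOpen_univ (hY.isSmoothFieldOn _) (hZ.isSmoothFieldOn _) hx (mem_univ _),
    ricci_eq htor hφ isOpen_univ (hZ.isSmoothFieldOn _) (hY.isSmoothFieldOn _) hx (mem_univ _),
    hY', hZ', φ.right_inv hy] at h
  simpa [stdVec, Pi.single_apply] using h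

end CottonTensor

/-! ### The acceleration of a curve in an arbitrary chart. -/

section Acceleration

variable {M : Type*} [TopologicalSpace M] [T2Space M] [ChartedSpace Plane M]
  [IsManifold (𝓡 2) ∞ M] {φ : OpenPartialHomeomorph M Plane}
  {cov : Connection M} [cov.ContMDiffCovariantDerivative ∞]

lemma trivializationAt_snd {x y : M} (hy : y ∈ (chartAt Plane x).source)
    (v : TangentSpace (𝓡 2) y) :
    (trivializationAt Plane (TangentSpace (𝓡 2) : M → Type _) x ⟨y, v⟩).2 =
      dchart (chartAt Plane x) y v := by
  set e := trivializationAt Plane (TangentSpace (𝓡 2) : M → Type _) x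
  have h := TangentBundle.continuousLinearMapAt_trivializationAt (I := 𝓡 2) hy
  have h1 : e.continuousLinearMapAt ℝ y v = (e ⟨y, v⟩).2 := by
    rw [Trivialization.continuousLinearMapAt_apply, Trivialization.linearMapAt_apply,
      if_pos (by simpa [e] using hy)]
  rw [← h1, h]
  have h2 : (extChartAt (𝓡 2) x : M → Plane) = chartAt Plane x := by
    ext y
    simp
  rw [h2]
  rfl

lemma dchart_trivializationAt_symm {x y : M} (hy : y ∈ (chartAt Plane x).source) (w : Plane) :
    dchart (chartAt Plane x) y
      ((trivializationAt Plane (TangentSpace (𝓡 2) : M → Type _) x).symm y w) = w := by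
  rw [← trivializationAt_snd hy, Trivialization.apply_mk_symm]
  simpa using hy

lemma trivializationAt_symm_eq {x y : M} (hy : y ∈ (chartAt Plane x).source) (w : Plane) :
    (trivializationAt Plane (TangentSpace (𝓡 2) : M → Type _) x).symm y w =
      coordField (chartAt Plane x) w y := by
  have h := IsManifold.chart_mem_maximalAtlas (I := 𝓡 2) (n := ∞) x
  apply dchart_injective h hy
  rw [dchart_trivializationAt_symm hy, dchart_coordField h hy]

lemma coordField_eq_sum {ψ : OpenPartialHomeomorph M Plane}
    (hψ : ψ ∈ IsManifold.maximalAtlas (𝓡 2) ∞ M) {y : M} (hy : y ∈ ψ.source) (w : Plane) :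
    coordField ψ w y = ∑ i, w i • coordField ψ (stdVec i) y := by
  apply dchart_injective hψ hy
  simp only [map_sum, map_smul, dchart_coordField hψ hy, sum_smul_stdVec]

/-- On the domain of the preferred chart, `extend` is the field with constant coordinates, which is
what makes `covDerivAlong` computable. -/
lemma extend_eq {x y : M} (hy : y ∈ (chartAt Plane x).source) (v : TangentSpace (𝓡 2) x) :
    extend Plane v y = coordField (chartAt Plane x) (dchart (chartAt Plane x) x v) y := by
  rw [← trivializationAt_symm_eq hy, ← trivializationAt_snd (mem_chart_source _ x)]
  rfl

/-- The velocity of a curve in a chart. -/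
lemma dchart_velocity (hφ : φ ∈ IsManifold.maximalAtlas (𝓡 2) ∞ M) {γ : ℝ → M} {t : ℝ}
    (hγ : MDifferentiableAt 𝓘(ℝ, ℝ) (𝓡 2) γ t) (ht : γ t ∈ φ.source) :
    dchart φ (γ t) (velocity γ t) = deriv (φ ∘ γ) t := by
  have h := mfderiv_comp_apply t
    ((mdifferentiable_of_mem_maximalAtlas hφ).mdifferentiableAt ht) hγ (1 : ℝ)
  have h2 : mfderiv 𝓘(ℝ, ℝ) (𝓡 2) (φ ∘ γ) t = fderiv ℝ (φ ∘ γ) t := mfderiv_eq_fderiv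
  rw [h2] at h
  exact h.symm

lemma contDiffOn_chart_comp (hφ : φ ∈ IsManifold.maximalAtlas (𝓡 2) ∞ M) {γ : ℝ → M} {J : Set ℝ}
    (hγ : ContMDiffOn 𝓘(ℝ, ℝ) (𝓡 2) ∞ γ J) (hJ : MapsTo γ J φ.source) :
    ContDiffOn ℝ ∞ (φ ∘ γ) J :=
  ContMDiffOn.contDiffOn ((contMDiffOn_of_mem_maximalAtlas hφ).comp hγ hJ)

/-- The acceleration of a curve in a chart. -/
theorem dchart_acceleration (cov : Connection M) (hφ : φ ∈ IsManifold.maximalAtlas (𝓡 2) ∞ M)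
    {γ : ℝ → M} {J : Set ℝ}
    (hJ : IsOpen J) (hγ : ContMDiffOn 𝓘(ℝ, ℝ) (𝓡 2) ∞ γ J) {t : ℝ} (ht : t ∈ J)
    (htφ : γ t ∈ φ.source) (l : Fin 2) :
    dchart φ (γ t) (acceleration cov γ t) l = deriv (deriv (φ ∘ γ)) t l +
      ∑ i, ∑ k, deriv (φ ∘ γ) t i * christoffel cov φ l i k (φ (γ t)) * deriv (φ ∘ γ) t k := by
  -- The definition of acceleration uses the preferred chart `ψ` at `γ t`. The velocity is expanded
  -- in the coordinate fields of `ψ`, with coefficients `u`, and then read in `φ`.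
  set ψ := chartAt Plane (γ t) with hψdef
  have hψ : ψ ∈ IsManifold.maximalAtlas (𝓡 2) ∞ M := IsManifold.chart_mem_maximalAtlas _
  have htψ : γ t ∈ ψ.source := mem_chart_source _ _
  set u := deriv (ψ ∘ γ) with hu
  set c := φ ∘ γ with hc
  set W : Fin 2 → VField M := fun i ↦ coordField ψ (stdVec i) with hW
  set J' := J ∩ γ ⁻¹' (φ.source ∩ ψ.source) with hJ'
  have hJo : IsOpen J' :=
    hγ.continuousOn.isOpen_inter_preimage hJ (φ.open_source.inter ψ.open_source)
  have htJ : t ∈ J' := ⟨ht, htφ, htψ⟩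
  have hJn : J' ∈ 𝓝 t := hJo.mem_nhds htJ
  have hγ' := hγ.mono (inter_subset_left : J' ⊆ J)
  have hcs : ContDiffOn ℝ ∞ c J' := contDiffOn_chart_comp hφ hγ' fun s hs ↦ hs.2.1
  have hus : ContDiffOn ℝ ∞ u J' :=
    (contDiffOn_chart_comp hψ hγ' fun s hs ↦ hs.2.2).deriv_of_isOpen hJo (by simp)
  have hcd : DifferentiableAt ℝ c t := (hcs.contDiffAt hJn).differentiableAt (by simp)
  have hud : DifferentiableAt ℝ u t := (hus.contDiffAt hJn).differentiableAt (by simp)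
  have hγd : ∀ s ∈ J', MDifferentiableAt 𝓘(ℝ, ℝ) (𝓡 2) γ s := fun s hs ↦
    ((hγ' s hs).contMDiffAt (hJo.mem_nhds hs)).mdifferentiableAt (by simp)
  have hWs : ∀ i, DiffFieldAt (W i) (γ t) := fun i ↦
    (isSmoothFieldOn_coordField hψ (stdVec i)).diffFieldAt ψ.open_source htψ
  have hR : ∀ i, DifferentiableAt ℝ (rep φ (W i)) (c t) := fun i ↦
    (hWs i).differentiableAt_rep hφ htφ
  have hvel : ∀ s ∈ J', velocity γ s = ∑ i, u s i • W i (γ s) := by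
    intro s hs
    apply dchart_injective hψ hs.2.2
    rw [dchart_velocity hψ (hγd s hs) hs.2.2]
    simp only [map_sum, map_smul, hW, dchart_coordField hψ hs.2.2, sum_smul_stdVec, hu]
  have hc' : deriv c =ᶠ[𝓝 t] fun s ↦ ∑ i, u s i • rep φ (W i) (c s) := by
    filter_upwards [hJn] with s hs
    rw [← dchart_velocity hφ (hγd s hs) hs.2.1, hvel s hs]
    simp only [map_sum, map_smul, hc, Function.comp_apply, rep_apply_chart hs.2.1]
  -- Of the two terms in the product rule, the one with `deriv u` is the first summand of
  -- `covDerivAlong`; the other is the directional derivative inside `cov (extend ...)`.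
  have hc'' : deriv (deriv c) t = ∑ i, (u t i • fderiv ℝ (rep φ (W i)) (c t) (deriv c t) +
      deriv u t i • rep φ (W i) (c t)) := by
    rw [hc'.deriv_eq]
    refine HasDerivAt.deriv (HasDerivAt.fun_sum fun i _ ↦ ?_)
    exact HasDerivAt.smul (((EuclideanSpace.proj (𝕜 := ℝ) i).hasFDerivAt.comp_hasDerivAt t
      hud.hasDerivAt)) ((hR i).hasFDerivAt.comp_hasDerivAt t hcd.hasDerivAt)
  have hder : deriv (fun s ↦ (trivializationAt Plane (TangentSpace (𝓡 2) : M → Type _) (γ t)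
      ⟨γ s, velocity γ s⟩).2) t = deriv u t := by
    refine Filter.EventuallyEq.deriv_eq ?_
    filter_upwards [hJn] with s hs
    rw [trivializationAt_snd hs.2.2, dchart_velocity hψ (hγd s hs) hs.2.2]
  have hext : ∀ᶠ z in 𝓝 (γ t), extend Plane (velocity γ t) z = ∑ i, u t i • W i z := by
    filter_upwards [ψ.open_source.mem_nhds htψ] with z hz
    rw [extend_eq hz, dchart_velocity hψ (hγd t htJ) htψ, coordField_eq_sum hψ hz]
  obtain ⟨v, hv, htv, hvs⟩ := exists_isSmoothFieldOn_extend (velocity γ t)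
  have hrep : rep φ (extend Plane (velocity γ t)) =ᶠ[𝓝 (c t)]
      fun y ↦ ∑ i, u t i • rep φ (W i) y := by
    have h1 : Tendsto φ.symm (𝓝 (c t)) (𝓝 (γ t)) := by
      have := (φ.continuousAt_symm (φ.map_source htφ)).tendsto
      rwa [φ.left_inv htφ] at this
    filter_upwards [h1.eventually hext] with y hy
    simp only [rep, hy, map_sum, map_smul]
  have hacc : acceleration cov γ t = coordField ψ (deriv u t) (γ t) +
      cov (extend Plane (velocity γ t)) (γ t) (velocity γ t) := by
    rw [← trivializationAt_symm_eq htψ, ← hder]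
    rfl
  have hfd : fderiv ℝ (fun y ↦ rep φ (extend Plane (velocity γ t)) y l) (c t) (deriv c t) =
      ∑ i, u t i * (fderiv ℝ (rep φ (W i)) (c t) (deriv c t)) l := by
    have h1 : (fun y ↦ rep φ (extend Plane (velocity γ t)) y l) =ᶠ[𝓝 (c t)]
        fun y ↦ ∑ i, u t i * rep φ (W i) y l := by
      filter_upwards [hrep] with y hy
      simp [hy]
    have h2 : ∀ i, HasFDerivAt (fun y ↦ rep φ (W i) y l)
        ((EuclideanSpace.proj (𝕜 := ℝ) l).comp (fderiv ℝ (rep φ (W i)) (c t))) (c t) := fun i ↦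
      (EuclideanSpace.proj (𝕜 := ℝ) l).hasFDerivAt.comp (c t) (hR i).hasFDerivAt
    rw [h1.fderiv_eq, (HasFDerivAt.fun_sum fun i _ ↦ (h2 i).const_mul (u t i)).fderiv]
    simp
  have hval : ∀ k, rep φ (extend Plane (velocity γ t)) (φ (γ t)) k = deriv c t k := fun k ↦ by
    rw [rep_apply_chart htφ, extend_apply_self, dchart_velocity hφ (hγd t htJ) htφ]
  rw [hacc, map_add, PiLp.add_apply, dchart_cov cov hφ htφ (hvs.diffFieldAt hv htv), hc'']
  simp only [hval, mul_add, Finset.sum_add_distrib]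
  rw [dchart_velocity hφ (hγd t htJ) htφ, ← fderiv_apply_eq_sum_pd]
  have hct : φ (γ t) = c t := rfl
  have hcf : dchart φ (γ t) (coordField ψ (deriv u t) (γ t)) =
      ∑ i, deriv u t i • rep φ (W i) (c t) := by
    rw [coordField_eq_sum hψ htψ, map_sum, ← hct]
    simp only [map_smul, rep_apply_chart htφ, hW]
  rw [hct, ← hc, hfd, hcf]
  simp only [Fin.sum_univ_two, PiLp.add_apply, PiLp.smul_apply, smul_eq_mul]
  ring

end Acceleration

/-! ### Straight geodesics force `Y_abc = 0`. -/

section StraightGeodesics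

section LocalTensors

variable {Γ : Symbols} {u : Set Plane}

/-- Symbols whose geodesics are straight lines have vanishing `cotton`, provided that their Ricci
tensor is symmetric. -/
theorem cotton_eq_zero_of_eq (hu : IsOpen u) (hΓ : ∀ k i j, ContDiffOn ℝ ∞ (Γ k i j) u)
    (hsymm : ∀ k, ∀ y ∈ u, Γ k 1 0 y = Γ k 0 1 y) (hric : ∀ y ∈ u, ric Γ 1 0 y = ric Γ 0 1 y)
    (h1 : ∀ y ∈ u, Γ 1 0 0 y = 0) (h2 : ∀ y ∈ u, Γ 0 1 1 y = 0)
    (h3 : ∀ y ∈ u, Γ 0 0 0 y = 2 * Γ 1 0 1 y) (h4 : ∀ y ∈ u, Γ 1 1 1 y = 2 * Γ 0 0 1 y)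
    {y : Plane} (hy : y ∈ u) (i j k : Fin 2) : cotton Γ i j k y = 0 := by
  -- With `p_0 = p` and `p_1 = q`, the hypotheses say `Γ^k_ij = δ^k_i p_j + δ^k_j p_i`.
  set p := Γ 1 0 1 with hp
  set q := Γ 0 0 1 with hq
  have cp : ContDiffOn ℝ ∞ p u := hΓ 1 0 1
  have cq : ContDiffOn ℝ ∞ q u := hΓ 0 0 1
  have ev : ∀ {f g : Plane → ℝ}, (∀ z ∈ u, f z = g z) → ∀ z ∈ u, ∀ a, pd a f z = pd a g z :=
    fun hfg z hz a ↦ pd_congr (by filter_upwards [hu.mem_nhds hz] with w hw using hfg w hw) a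
  have pd0 : ∀ (a : Fin 2) (z : Plane), pd a (fun _ ↦ (0 : ℝ)) z = 0 := fun a z ↦ by simp [pd]
  have pd2 : ∀ {f : Plane → ℝ}, ContDiffOn ℝ ∞ f u → ∀ z ∈ u, ∀ a,
      pd a (fun z ↦ 2 * f z) z = 2 * pd a f z := fun hf z hz a ↦ by
    rw [pd, pd, fderiv_const_mul (hf.differentiableAt_of_isOpen hu hz)]
    simp
  have e1 : ∀ z ∈ u, ∀ a, pd a (Γ 1 0 0) z = 0 := fun z hz a ↦ by rw [ev h1 z hz, pd0]
  have e2 : ∀ z ∈ u, ∀ a, pd a (Γ 0 1 1) z = 0 := fun z hz a ↦ by rw [ev h2 z hz, pd0]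
  have e3 : ∀ z ∈ u, ∀ a, pd a (Γ 0 0 0) z = 2 * pd a p z := fun z hz a ↦ by
    rw [ev h3 z hz, pd2 cp z hz]
  have e4 : ∀ z ∈ u, ∀ a, pd a (Γ 1 1 1) z = 2 * pd a q z := fun z hz a ↦ by
    rw [ev h4 z hz, pd2 cq z hz]
  have e5 : ∀ z ∈ u, ∀ a, pd a (Γ 1 1 0) z = pd a p z := fun z hz a ↦ ev (hsymm 1) z hz a
  have e6 : ∀ z ∈ u, ∀ a, pd a (Γ 0 1 0) z = pd a q z := fun z hz a ↦ ev (hsymm 0) z hz a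
  have hval : ∀ z ∈ u, ric Γ 0 0 z = p z * p z - pd 0 p z ∧
      ric Γ 0 1 z = p z * q z + pd 1 p z - 2 * pd 0 q z ∧
      ric Γ 1 0 z = p z * q z + pd 0 q z - 2 * pd 1 p z ∧
      ric Γ 1 1 z = q z * q z - pd 1 q z := by
    intro z hz
    simp only [ric, riem, Fin.sum_univ_two, e1 z hz, e2 z hz, e3 z hz, e4 z hz, e5 z hz, e6 z hz,
      h1 z hz, h2 z hz, h3 z hz, h4 z hz, hsymm _ z hz, ← hp, ← hq]
    refine ⟨?_, ?_, ?_, ?_⟩ <;> ring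
  -- The antisymmetric part of Ricci is a multiple of `dp`: `R_01 - R_10 = 3 (∂_1 p - ∂_0 q)`.
  have hpq : ∀ z ∈ u, pd 0 q z = pd 1 p z := fun z hz ↦ by
    have h := hric z hz
    rw [(hval z hz).2.1, (hval z hz).2.2.1] at h
    linarith
  have r00 : ∀ z ∈ u, ric Γ 0 0 z = p z * p z + (-1) * pd 0 p z := fun z hz ↦ by
    rw [(hval z hz).1]; ring
  have r11 : ∀ z ∈ u, ric Γ 1 1 z = q z * q z + (-1) * pd 1 q z := fun z hz ↦ by
    rw [(hval z hz).2.2.2]; ring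
  have r01 : ∀ z ∈ u, ric Γ 0 1 z = p z * q z + (-1) * pd 1 p z := fun z hz ↦ by
    rw [(hval z hz).2.1, hpq z hz]; ring
  have r10 : ∀ z ∈ u, ric Γ 1 0 z = p z * q z + (-1) * pd 1 p z := fun z hz ↦ by
    rw [hric z hz, r01 z hz]
  have dp := cp.differentiableAt_of_isOpen hu hy
  have dq := cq.differentiableAt_of_isOpen hu hy
  have dpd : ∀ {f g h : Plane → ℝ}, ContDiffOn ℝ ∞ f u → ContDiffOn ℝ ∞ g u →
      ContDiffOn ℝ ∞ h u → ∀ a b, pd a (fun z ↦ f z * g z + (-1) * pd b h z) y =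
        pd a f y * g y + f y * pd a g y - pd a (pd b h) y := by
    intro f g h hf hg hh a b
    have df := hf.differentiableAt_of_isOpen hu hy
    have dg := hg.differentiableAt_of_isOpen hu hy
    have dh := (contDiffOn_pd hu hh b).differentiableAt_of_isOpen hu hy
    rw [pd_add (f := fun z ↦ f z * g z) (g := fun z ↦ (-1) * pd b h z) (df.mul dg)
      (dh.const_mul _), pd_mul df dg, pd_mul (differentiableAt_const _) dh]
    simp [pd]
    ring
  have q10 : pd 1 (pd 0 p) y = pd 0 (pd 1 p) y := pd_comm hu cp hy 1 0
  have q01 : pd 0 (pd 1 q) y = pd 1 (pd 1 p) y := by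
    rw [pd_comm hu cq hy 0 1, ev hpq y hy]
  have hv := hpq y hy
  have k00 := r00 y hy
  have k01 := r01 y hy
  have k10 := r10 y hy
  have k11 := r11 y hy
  fin_cases i <;> fin_cases j <;> fin_cases k <;>
    simp only [cotton, Fin.zero_eta, Fin.mk_one, Fin.sum_univ_two, ev r00 y hy, ev r11 y hy,
      ev r01 y hy, ev r10 y hy, dpd cp cp cp, dpd cq cq cq, dpd cp cq cp, k00, k01, k10, k11,
      h1 y hy, h2 y hy, h3 y hy, h4 y hy, hsymm _ y hy, ← hp, ← hq, q10, q01, hv] <;> ring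

end LocalTensors

section Geodesics

lemma _root_.ContDiffOn.of_hasDerivAt_comp {E : Type*} [NormedAddCommGroup E] [NormedSpace ℝ E]
    {F : E → E} {Ω : Set E} (hF : ContDiffOn ℝ ∞ F Ω) {α : ℝ → E} {I : Set ℝ} (hI : IsOpen I)
    (hα : ∀ t ∈ I, HasDerivAt α (F (α t)) t) (hΩ : MapsTo α I Ω) : ContDiffOn ℝ ∞ α I := by
  rw [contDiffOn_infty]
  intro n
  induction n with
  | zero =>
    exact contDiffOn_zero.2 fun t ht ↦ (hα t ht).continuousAt.continuousWithinAt
  | succ n ih =>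
    push_cast
    rw [contDiffOn_succ_iff_deriv_of_isOpen hI]
    refine ⟨fun t ht ↦ (hα t ht).differentiableAt.differentiableWithinAt, by simp, ?_⟩
    exact ((hF.of_le (mod_cast le_top)).comp ih hΩ).congr fun t ht ↦ (hα t ht).deriv

/-- Local existence of geodesics. -/
theorem exists_geodesic {Γ : Symbols} {u : Set Plane} (hu : IsOpen u)
    (hΓ : ∀ k i j, ContDiffOn ℝ ∞ (Γ k i j) u) {y : Plane} (hy : y ∈ u) {v : Plane} (hv : v ≠ 0) :
    ∃ (c : ℝ → Plane) (J : Set ℝ), IsOpen J ∧ J.OrdConnected ∧ (0 : ℝ) ∈ J ∧ ContDiffOn ℝ ∞ c J ∧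
      MapsTo c J u ∧ c 0 = y ∧ deriv c 0 = v ∧ ∀ t ∈ J, deriv c t ≠ 0 ∧
        ∀ l, deriv (deriv c) t l + ∑ i, ∑ k, deriv c t i * Γ l i k (c t) * deriv c t k = 0 := by
  -- The geodesic equation as a first-order system for position and velocity.
  let F : Plane × Plane → Plane × Plane := fun z ↦
    (z.2, WithLp.toLp 2 fun l ↦ -∑ i, ∑ k, z.2 i * Γ l i k z.1 * z.2 k)
  have hF : ContDiffOn ℝ ∞ F (u ×ˢ univ) := by
    refine contDiffOn_snd.prodMk ?_
    rw [contDiffOn_euclidean]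
    intro l
    have hc : ∀ i : Fin 2, ContDiffOn ℝ ∞ (fun z : Plane × Plane ↦ z.2 i) (u ×ˢ univ) := fun i ↦
      (EuclideanSpace.proj (𝕜 := ℝ) i).contDiff.comp_contDiffOn contDiffOn_snd
    refine (ContDiffOn.sum fun i _ ↦ ContDiffOn.sum fun k _ ↦ ?_).neg
    exact ((hc i).mul ((hΓ l i k).comp contDiffOn_fst fun z hz ↦ hz.1)).mul (hc k)
  have hFo : IsOpen (u ×ˢ (univ : Set Plane)) := hu.prod isOpen_univ
  have hFy : (y, v) ∈ u ×ˢ (univ : Set Plane) := ⟨hy, mem_univ _⟩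
  obtain ⟨α, hα0, ε, hε, hα⟩ :=
    ((hF.contDiffAt (hFo.mem_nhds hFy)).of_le
      (mod_cast le_top : (1 : ℕ∞ω) ≤ ∞)).exists_forall_mem_closedBall_exists_eq_forall_mem_Ioo_hasDerivAt₀ 0
  have hcont : ContinuousAt α 0 := (hα 0 (by simpa using hε)).continuousAt
  have hgood : ∀ᶠ t in 𝓝 (0 : ℝ), t ∈ Ioo (0 - ε) (0 + ε) ∧ (α t).1 ∈ u ∧ (α t).2 ≠ 0 := by
    have hI : ∀ᶠ t in 𝓝 (0 : ℝ), t ∈ Ioo (0 - ε) (0 + ε) :=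
      isOpen_Ioo.mem_nhds (by simpa using hε)
    refine hI.and (Filter.Eventually.and ?_ ?_)
    · exact (continuous_fst.continuousAt.comp hcont).eventually
        (hu.mem_nhds (by simpa [hα0] using hy))
    · exact (continuous_snd.continuousAt.comp hcont).eventually_ne (by simpa [hα0] using hv)
  obtain ⟨δ, hδ, hδ'⟩ := Metric.eventually_nhds_iff_ball.1 hgood
  rw [Real.ball_eq_Ioo] at hδ'
  have hder : ∀ t ∈ Ioo (0 - δ) (0 + δ), HasDerivAt α (F (α t)) t := fun t ht ↦ hα t (hδ' t ht).1
  have h1 : ∀ t ∈ Ioo (0 - δ) (0 + δ), HasDerivAt (fun t ↦ (α t).1) (α t).2 t := fun t ht ↦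
    (hder t ht).fst
  have h2 : ∀ t ∈ Ioo (0 - δ) (0 + δ), HasDerivAt (fun t ↦ (α t).2) (F (α t)).2 t := fun t ht ↦
    (hder t ht).snd
  have h0 : (0 : ℝ) ∈ Ioo (0 - δ) (0 + δ) := by simpa using hδ
  have h3 : ∀ t ∈ Ioo (0 - δ) (0 + δ), deriv (deriv fun t ↦ (α t).1) t = (F (α t)).2 := by
    intro t ht
    rw [← (h2 t ht).deriv]
    refine Filter.EventuallyEq.deriv_eq ?_
    filter_upwards [isOpen_Ioo.mem_nhds ht] with s hs using (h1 s hs).deriv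
  have hsm : ContDiffOn ℝ ∞ α (Ioo (0 - δ) (0 + δ)) :=
    hF.of_hasDerivAt_comp isOpen_Ioo hder fun t ht ↦ ⟨(hδ' t ht).2.1, mem_univ _⟩
  refine ⟨fun t ↦ (α t).1, Ioo (0 - δ) (0 + δ), isOpen_Ioo, ordConnected_Ioo, h0,
    contDiff_fst.comp_contDiffOn hsm, fun t ht ↦ (hδ' t ht).2.1, by simp only [hα0],
    by rw [(h1 0 h0).deriv, hα0], fun t ht ↦ ⟨by rw [(h1 t ht).deriv]; exact (hδ' t ht).2.2, ?_⟩⟩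
  intro l
  rw [h3 t ht, (h1 t ht).deriv]
  simp [F]
  ring

/-- A curve contained in a line has parallel first and second derivatives. -/
lemma deriv_mul_deriv_deriv_eq {c : ℝ → Plane} {J : Set ℝ} (hJ : IsOpen J)
    (hc : ContDiffOn ℝ ∞ c J) {L : AffineSubspace ℝ Plane}
    (hL : Module.finrank ℝ L.direction = 1) (hcL : ∀ t ∈ J, c t ∈ L) {t : ℝ} (ht : t ∈ J) :
    deriv c t 0 * deriv (deriv c) t 1 = deriv c t 1 * deriv (deriv c) t 0 := by
  obtain ⟨⟨d, hd⟩, hd0, hspan⟩ := finrank_eq_one_iff'.1 hL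
  have hd0' : d ≠ 0 := fun h ↦ hd0 (by simpa using h)
  -- A functional vanishing on the direction of the line: it is constant along `c`, so it kills both
  -- derivatives.
  let n : Plane →L[ℝ] ℝ := d 1 • EuclideanSpace.proj 0 - d 0 • EuclideanSpace.proj 1
  have hn : ∀ w, n w = d 1 * w 0 - d 0 * w 1 := fun w ↦ rfl
  have hnc : ∀ s ∈ J, n (c s) = n (c t) := by
    intro s hs
    have h := L.vsub_mem_direction (hcL s hs) (hcL t ht)
    obtain ⟨a, ha⟩ := hspan ⟨_, h⟩
    have ha' : a • d = c s - c t := congrArg Subtype.val ha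
    have h1 : n (c s - c t) = 0 := by
      rw [← ha', hn]
      simp
      ring
    rwa [map_sub, sub_eq_zero] at h1
  have hd1 : DifferentiableOn ℝ c J := hc.differentiableOn (by simp)
  have hd2 : DifferentiableOn ℝ (deriv c) J :=
    (hc.deriv_of_isOpen (m := ∞) hJ (by simp)).differentiableOn (by simp)
  have hn1 : ∀ s ∈ J, n (deriv c s) = 0 := by
    intro s hs
    have h : HasDerivAt (fun s ↦ n (c s)) (n (deriv c s)) s :=
      n.hasFDerivAt.comp_hasDerivAt s (hd1.differentiableAt (hJ.mem_nhds hs)).hasDerivAt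
    have h' : (fun s ↦ n (c s)) =ᶠ[𝓝 s] fun _ ↦ n (c t) := by
      filter_upwards [hJ.mem_nhds hs] with r hr using hnc r hr
    rw [← h.deriv, h'.deriv_eq, deriv_const]
  have hn2 : n (deriv (deriv c) t) = 0 := by
    have h : HasDerivAt (fun s ↦ n (deriv c s)) (n (deriv (deriv c) t)) t :=
      n.hasFDerivAt.comp_hasDerivAt t (hd2.differentiableAt (hJ.mem_nhds ht)).hasDerivAt
    have h' : (fun s ↦ n (deriv c s)) =ᶠ[𝓝 t] fun _ ↦ 0 := by
      filter_upwards [hJ.mem_nhds ht] with r hr using hn1 r hr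
    rw [← h.deriv, h'.deriv_eq, deriv_const]
  have e1 := hn1 t ht
  rw [hn] at e1 hn2
  have hd01 : d 0 ≠ 0 ∨ d 1 ≠ 0 := by
    by_contra! h
    exact hd0' (by ext i; fin_cases i <;> simp [h])
  rcases hd01 with h | h
  · apply mul_left_cancel₀ h
    linear_combination (-deriv c t 0) * hn2 + deriv (deriv c) t 0 * e1
  · apply mul_left_cancel₀ h
    linear_combination (-deriv c t 1) * hn2 + deriv (deriv c) t 1 * e1

end Geodesics

variable {M : Type*} [TopologicalSpace M] [T2Space M] [ChartedSpace Plane M]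
  [IsManifold (𝓡 2) ∞ M] {φ : OpenPartialHomeomorph M Plane}
  {cov : Connection M} [cov.ContMDiffCovariantDerivative ∞]

lemma isUnparamGeodesicOn_symm_comp (hφ : φ ∈ IsManifold.maximalAtlas (𝓡 2) ∞ M) {c : ℝ → Plane}
    {J : Set ℝ} (hJ : IsOpen J) (hJ' : J.OrdConnected) (hc : ContDiffOn ℝ ∞ c J)
    (hcφ : MapsTo c J φ.target) (hc0 : ∀ t ∈ J, deriv c t ≠ 0)
    (hgeo : ∀ t ∈ J, ∀ l, deriv (deriv c) t l +
      ∑ i, ∑ k, deriv c t i * christoffel cov φ l i k (c t) * deriv c t k = 0) :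
    IsUnparamGeodesicOn cov (φ.symm ∘ c) J := by
  have hsm : ContMDiffOn 𝓘(ℝ, ℝ) (𝓡 2) ∞ (φ.symm ∘ c) J :=
    (contMDiffOn_symm_of_mem_maximalAtlas hφ).comp hc.contMDiffOn hcφ
  have hsrc : ∀ t ∈ J, (φ.symm ∘ c) t ∈ φ.source := fun t ht ↦ φ.map_target (hcφ ht)
  have hev : ∀ t ∈ J, φ ∘ φ.symm ∘ c =ᶠ[𝓝 t] c := fun t ht ↦ by
    filter_upwards [hJ.mem_nhds ht] with s hs using φ.right_inv (hcφ hs)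
  refine ⟨hJ, hJ', hsm, fun t ht h0 ↦ ?_, fun _ ↦ 0, contDiffOn_const, fun t ht ↦ ?_⟩
  · apply hc0 t ht
    have h := dchart_velocity hφ (((hsm t ht).contMDiffAt
      (hJ.mem_nhds ht)).mdifferentiableAt (by simp)) (hsrc t ht)
    rw [h0, map_zero, (hev t ht).deriv_eq] at h
    exact h.symm
  · rw [zero_smul]
    apply dchart_injective hφ (hsrc t ht)
    rw [map_zero]
    ext l
    rw [dchart_acceleration cov hφ hJ hsm ht (hsrc t ht), (hev t ht).deriv.deriv_eq,
      (hev t ht).deriv_eq]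
    have := hgeo t ht l
    simpa [φ.right_inv (hcφ ht)] using this

/-- The geodesic through `y` with velocity `v` lies on a line, so `Γ(v, v)` is parallel to `v`. This
is the vanishing of a binary cubic form in `v`; its four coefficients are found from four pairwise
independent vectors. -/
lemma christoffel_of_geodesicsAreStraightIn (htor : cov.torsion = 0)
    (hφ : φ ∈ IsManifold.maximalAtlas (𝓡 2) ∞ M) (h : GeodesicsAreStraightIn cov φ) {y : Plane}
    (hy : y ∈ φ.target) :
    christoffel cov φ 1 0 0 y = 0 ∧ christoffel cov φ 0 1 1 y = 0 ∧
      christoffel cov φ 0 0 0 y = 2 * christoffel cov φ 1 0 1 y ∧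
      christoffel cov φ 1 1 1 y = 2 * christoffel cov φ 0 0 1 y := by
  set Γ := christoffel cov φ with hΓ
  have key : ∀ v : Plane, v ≠ 0 → v 0 * (∑ i, ∑ k, v i * Γ 1 i k y * v k) =
      v 1 * (∑ i, ∑ k, v i * Γ 0 i k y * v k) := by
    intro v hv
    obtain ⟨c, J, hJ, hJ', h0, hc, hcφ, hc0, hc1, hgeo⟩ :=
      exists_geodesic φ.open_target (contDiffOn_christoffel cov hφ) hy hv
    obtain ⟨L, hL, hcL⟩ := h _ J (isUnparamGeodesicOn_symm_comp hφ hJ hJ' hc hcφ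
      (fun t ht ↦ (hgeo t ht).1) fun t ht ↦ (hgeo t ht).2) fun t ht ↦ φ.map_target (hcφ ht)
    have h1 := deriv_mul_deriv_deriv_eq hJ hc hL (fun t ht ↦ by
      simpa [φ.right_inv (hcφ ht)] using hcL t ht) h0
    have g0 := (hgeo 0 h0).2 0
    have g1 := (hgeo 0 h0).2 1
    rw [hc0, hc1, ← hΓ] at g0 g1
    rw [hc1] at h1
    linear_combination v 0 * g1 - v 1 * g0 - h1
  have hs : ∀ k, Γ k 1 0 y = Γ k 0 1 y := fun k ↦ christoffel_symm htor hφ hy k 1 0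
  have hne : ∀ a b : ℝ, a ≠ 0 ∨ b ≠ 0 → !₂[a, b] ≠ 0 := by
    intro a b hab h
    have h0 := congrArg (· 0) h
    have h1 := congrArg (· 1) h
    simp at h0 h1
    tauto
  have k1 := key !₂[1, 0] (hne _ _ (by simp))
  have k2 := key !₂[0, 1] (hne _ _ (by simp))
  have k3 := key !₂[1, 1] (hne _ _ (by simp))
  have k4 := key !₂[1, -1] (hne _ _ (by simp))
  simp [Fin.sum_univ_two, hs] at k1 k2 k3 k4
  refine ⟨k1, k2.symm, ?_, ?_⟩ <;> linarith

theorem tensorYVanishes_of_geodesicsAreStraightIn (htor : cov.torsion = 0)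
    (hsymm : HasSymmetricRicci cov) (h : ∀ p : M, ∃ φ ∈ IsManifold.maximalAtlas (𝓡 2) ∞ M,
      p ∈ φ.source ∧ GeodesicsAreStraightIn cov φ) : TensorYVanishes cov := by
  choose A hA hp hs using h
  rw [tensorYVanishes_iff htor A hA hp]
  intro x i j k
  have hΓ := fun y (hy : y ∈ (A x).target) ↦
    christoffel_of_geodesicsAreStraightIn htor (hA x) (hs x) hy
  exact cotton_eq_zero_of_eq (A x).open_target (contDiffOn_christoffel cov (hA x))
    (fun k y hy ↦ christoffel_symm htor (hA x) hy k 1 0)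
    (fun y hy ↦ ric_symm htor (hA x) hsymm hy 1 0) (fun y hy ↦ (hΓ y hy).1)
    (fun y hy ↦ (hΓ y hy).2.1) (fun y hy ↦ (hΓ y hy).2.2.1) (fun y hy ↦ (hΓ y hy).2.2.2)
    ((A x).map_source (hp x)) i j k

end StraightGeodesics

/-! ### Solutions of the projective linear system. -/

section ProjectiveCoordinates

section LinearSystems

/-- Frobenius theorem for linear systems on the plane, with values in a normed algebra. -/
lemma exists_fderiv_eq_mul {𝔸 : Type*} [NormedRing 𝔸] [NormedAlgebra ℝ 𝔸] [CompleteSpace 𝔸]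
    {u : Set Plane} (hu : IsOpen u) {A : Fin 2 → Plane → 𝔸} (hA : ∀ i, ContDiffOn ℝ ∞ (A i) u)
    (flat : ∀ y ∈ u, fderiv ℝ (A 1) y (stdVec 0) + A 1 y * A 0 y =
      fderiv ℝ (A 0) y (stdVec 1) + A 0 y * A 1 y) {p : Plane} (hp : p ∈ u) :
    ∃ (W : Set Plane) (F : Plane → 𝔸), IsOpen W ∧ p ∈ W ∧ W ⊆ u ∧ F p = 1 ∧ ContDiffOn ℝ ∞ F W ∧
      (∀ y ∈ W, ∀ i, fderiv ℝ F y (stdVec i) = A i y * F y) := by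
  let S : Fin 2 → 𝔸 →L[ℝ] Plane →L[ℝ] 𝔸 := fun i ↦
    ContinuousLinearMap.smulRightL ℝ Plane 𝔸 (EuclideanSpace.proj i)
  have hS : ∀ i a w, S i a w = w i • a := fun i a w ↦ rfl
  let B : Plane → Plane →L[ℝ] 𝔸 := fun y ↦ ∑ i, S i (A i y)
  have hB : ContDiffOn ℝ ∞ B u := ContDiffOn.sum fun i _ ↦ (S i).contDiff.comp_contDiffOn (hA i)
  have hBd : ∀ y ∈ u, ∀ a b, fderiv ℝ B y a b = ∑ i, b i • fderiv ℝ (A i) y a := by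
    intro y hy a b
    have h : HasFDerivAt B (∑ i, (S i).comp (fderiv ℝ (A i) y)) y :=
      HasFDerivAt.fun_sum fun i _ ↦ (S i).hasFDerivAt.comp y
        ((hA i).differentiableAt_of_isOpen hu hy).hasFDerivAt
    rw [h.fderiv]
    simp [hS]
  have hB1 : ∀ y w, B y w = ∑ i, w i • A i y := fun y w ↦ by
    simp [B, hS]
  obtain ⟨F, hF1, hF⟩ := exists_hasFDerivAt_of_flat (A := B) (p := p)
    ((hB.contDiffAt (hu.mem_nhds hp)).of_le ENat.LEInfty.out) (by
      filter_upwards [hu.mem_nhds hp] with y hy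
      -- Both sides differ by an alternating bilinear form in `a`, `b`, so the pair `(stdVec 0,
      -- stdVec 1)` suffices.
      intro a b
      have e : ∀ (f : Plane → 𝔸) (a : Plane), fderiv ℝ f y a =
          ∑ i, a i • fderiv ℝ f y (stdVec i) := fun f a ↦ by
        conv_lhs => rw [← sum_smul_stdVec a]
        simp
      have hfl : fderiv ℝ (A 1) y (stdVec 0) =
          fderiv ℝ (A 0) y (stdVec 1) + A 0 y * A 1 y - A 1 y * A 0 y :=
        eq_sub_of_add_eq (flat y hy)
      simp only [hBd y hy, hB1, Fin.sum_univ_two]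
      rw [e (A 0) a, e (A 1) a, e (A 0) b, e (A 1) b]
      simp only [Fin.sum_univ_two, hfl, add_mul, mul_add, smul_mul_assoc, mul_smul_comm, smul_add,
        smul_sub, smul_smul]
      module) 1
  obtain ⟨W, hW, hWo, hpW⟩ := eventually_nhds_iff.1 (hF.and (hu.mem_nhds hp))
  refine ⟨W, F, hWo, hpW, fun y hy ↦ (hW y hy).2, hF1,
    contDiffOn_of_hasFDerivAt_linear hWo (hB.mono fun y hy ↦ (hW y hy).2) fun y hy ↦ (hW y hy).1,
    fun y hy i ↦ ?_⟩
  rw [(hW y hy).1.fderiv]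
  have : B y (stdVec i) = A i y := by
    rw [hB1]
    simp [stdVec]
  simp [this]

/-- The matrix algebra enters only through its entry functionals and matrix units, so no norm on
matrices appears here. -/
lemma exists_pd_entry_eq_sum_mul {𝔸 : Type*} [NormedRing 𝔸] [NormedAlgebra ℝ 𝔸] [CompleteSpace 𝔸]
    {n : Type*} [Fintype n] [DecidableEq n] {entry : n → n → 𝔸 →L[ℝ] ℝ} {E : n → n → 𝔸}
    (entry_E : ∀ r s r' s', entry r s (E r' s') = if r' = r ∧ s' = s then 1 else 0)
    (entry_mul : ∀ r s P Q, entry r s (P * Q) = ∑ m, entry r m P * entry m s Q)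
    (entry_one : ∀ r s, entry r s 1 = if r = s then 1 else 0)
    (entry_ext : ∀ P Q, (∀ r s, entry r s P = entry r s Q) → P = Q) {u : Set Plane} (hu : IsOpen u)
    {A : Fin 2 → n → n → Plane → ℝ} (hA : ∀ i r s, ContDiffOn ℝ ∞ (A i r s) u)
    (flat : ∀ y ∈ u, ∀ r s, pd 0 (A 1 r s) y + ∑ m, A 1 r m y * A 0 m s y =
      pd 1 (A 0 r s) y + ∑ m, A 0 r m y * A 1 m s y) {p : Plane} (hp : p ∈ u) :
    ∃ (W : Set Plane) (F : n → n → Plane → ℝ), IsOpen W ∧ p ∈ W ∧ W ⊆ u ∧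
      (∀ r s, F r s p = if r = s then 1 else 0) ∧ (∀ r s, ContDiffOn ℝ ∞ (F r s) W) ∧
      (∀ y ∈ W, ∀ i r s, pd i (F r s) y = ∑ m, A i r m y * F m s y) := by
  have hpd : ∀ {N : Plane → 𝔸} {y : Plane}, DifferentiableAt ℝ N y → ∀ i r s,
      pd i (fun y ↦ entry r s (N y)) y = entry r s (fderiv ℝ N y (stdVec i)) := by
    intro N y hN i r s
    have h : HasFDerivAt (fun y ↦ entry r s (N y)) ((entry r s).comp (fderiv ℝ N y)) y :=
      (entry r s).hasFDerivAt.comp y hN.hasFDerivAt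
    rw [pd, h.fderiv]
    rfl
  let B : Fin 2 → Plane → 𝔸 := fun i y ↦ ∑ r, ∑ s, A i r s y • E r s
  have hBA : ∀ i r s y, entry r s (B i y) = A i r s y := by
    intro i r s y
    simp [B, entry_E, ite_and]
  have hB : ∀ i, ContDiffOn ℝ ∞ (B i) u := fun i ↦
    ContDiffOn.sum fun r _ ↦ ContDiffOn.sum fun s _ ↦ (hA i r s).smul contDiffOn_const
  obtain ⟨W, F, hW, hpW, hWu, hF1, hFs, hF⟩ := exists_fderiv_eq_mul hu hB (fun y hy ↦ by
    refine entry_ext _ _ fun r s ↦ ?_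
    rw [map_add, map_add, ← hpd ((hB 0).differentiableAt_of_isOpen hu hy),
      ← hpd ((hB 1).differentiableAt_of_isOpen hu hy), entry_mul, entry_mul]
    simp only [hBA]
    exact flat y hy r s) hp
  refine ⟨W, fun r s y ↦ entry r s (F y), hW, hpW, hWu, fun r s ↦ ?_,
    fun r s ↦ (entry r s).contDiff.comp_contDiffOn hFs, fun y hy i r s ↦ ?_⟩
  · simp only [hF1, entry_one]
  · rw [hpd (hFs.differentiableAt_of_isOpen hW hy), hF y hy, entry_mul]
    simp only [hBA]

/-- Frobenius theorem for linear systems on the plane. -/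
lemma exists_pd_eq_sum_mul {n : Type*} [Fintype n] [DecidableEq n] {u : Set Plane} (hu : IsOpen u)
    {A : Fin 2 → n → n → Plane → ℝ} (hA : ∀ i r s, ContDiffOn ℝ ∞ (A i r s) u)
    (flat : ∀ y ∈ u, ∀ r s, pd 0 (A 1 r s) y + ∑ m, A 1 r m y * A 0 m s y =
      pd 1 (A 0 r s) y + ∑ m, A 0 r m y * A 1 m s y) {p : Plane} (hp : p ∈ u) :
    ∃ (W : Set Plane) (F : n → n → Plane → ℝ), IsOpen W ∧ p ∈ W ∧ W ⊆ u ∧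
      (∀ r s, F r s p = if r = s then 1 else 0) ∧ (∀ r s, ContDiffOn ℝ ∞ (F r s) W) ∧
      (∀ y ∈ W, ∀ i r s, pd i (F r s) y = ∑ m, A i r m y * F m s y) := by
  let _ : NormedRing (Matrix n n ℝ) := Matrix.linftyOpNormedRing
  let _ : NormedAlgebra ℝ (Matrix n n ℝ) := Matrix.linftyOpNormedAlgebra
  have : CompleteSpace (Matrix n n ℝ) := FiniteDimensional.complete ℝ _
  exact exists_pd_entry_eq_sum_mul (𝔸 := Matrix n n ℝ)
    (entry := fun r s ↦ LinearMap.toContinuousLinearMap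
      { toFun := fun N ↦ N r s
        map_add' := fun _ _ ↦ rfl
        map_smul' := fun _ _ ↦ rfl })
    (E := fun r s ↦ Matrix.single r s 1)
    (fun r s r' s' ↦ Matrix.single_apply ..) (fun r s P Q ↦ Matrix.mul_apply)
    (fun r s ↦ Matrix.one_apply) (fun P Q h ↦ Matrix.ext h) hu hA flat hp

end LinearSystems

section Tractors

variable {Γ : Symbols} {u : Set Plane}

/-- The connection form of the linear system `∂_i ∂_j σ = Γ^k_ij ∂_k σ - R_ij σ`. -/
def tractorForm (Γ : Symbols) (i : Fin 2) (r s : Fin 3) : Plane → ℝ :=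
  Fin.cases (Fin.cases (fun _ ↦ 0) (fun k _ ↦ if i = k then 1 else 0) s)
    (fun j ↦ Fin.cases (fun y ↦ -ric Γ i j y) (fun k ↦ Γ k i j) s) r

/-- The values `(σ, ∂_0 σ, ∂_1 σ)` at `p` can be prescribed freely because `tractorForm` is flat.
The solutions `σ a` form the top row of the fundamental matrix that is the identity at `p`. -/
lemma exists_projective_coordinates (hu : IsOpen u) (hΓ : ∀ k i j, ContDiffOn ℝ ∞ (Γ k i j) u)
    (hsymm : ∀ k, ∀ y ∈ u, Γ k 1 0 y = Γ k 0 1 y) (hric : ∀ y ∈ u, ric Γ 1 0 y = ric Γ 0 1 y)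
    (hcot : ∀ y ∈ u, ∀ i j k, cotton Γ i j k y = 0) {p : Plane} (hp : p ∈ u) :
    ∃ (W : Set Plane) (σ : Fin 3 → Plane → ℝ), IsOpen W ∧ p ∈ W ∧ W ⊆ u ∧
      (∀ a, ContDiffOn ℝ ∞ (σ a) W) ∧
      (∀ a, σ a p = if 0 = a then 1 else 0) ∧
      (∀ (i : Fin 2) (a : Fin 3), pd i (σ a) p = if i.succ = a then 1 else 0) ∧
      ∀ a, ∀ y ∈ W, ∀ i j, pd i (pd j (σ a)) y =
        ∑ k, Γ k i j y * pd k (σ a) y - ric Γ i j y * σ a y := by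
  have h00 : ∀ i, tractorForm Γ i 0 0 = fun _ ↦ 0 := fun i ↦ rfl
  have h0s : ∀ i k, tractorForm Γ i 0 (Fin.succ k) = fun _ ↦ if i = k then 1 else 0 :=
    fun i k ↦ rfl
  have hs0 : ∀ i j, tractorForm Γ i (Fin.succ j) 0 = fun y ↦ -ric Γ i j y := fun i j ↦ rfl
  have hss : ∀ i j k, tractorForm Γ i (Fin.succ j) (Fin.succ k) = Γ k i j := fun i j k ↦ rfl
  have hA : ∀ i r s, ContDiffOn ℝ ∞ (tractorForm Γ i r s) u := by
    intro i r s
    refine Fin.cases (Fin.cases ?_ (fun k ↦ ?_) s) (fun j ↦ Fin.cases ?_ (fun k ↦ ?_) s) r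
    · exact contDiffOn_const
    · exact contDiffOn_const
    · exact (contDiffOn_ric hu hΓ i j).neg
    · exact hΓ k i j
  have pdc : ∀ (i : Fin 2) (a : ℝ) (y : Plane), pd i (fun _ ↦ a) y = 0 := fun i a y ↦ by simp [pd]
  have pdn : ∀ (i : Fin 2) (f : Plane → ℝ) (y : Plane), pd i (fun y ↦ -f y) y = -pd i f y :=
    fun i f y ↦ by simp [pd]
  obtain ⟨W, F, hW, hpW, hWu, hF1, hFs, hF⟩ := exists_pd_eq_sum_mul hu hA (fun y hy r s ↦ by
    have hsy := fun k ↦ hsymm k y hy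
    have hry := hric y hy
    rw [ric, ric, Fin.sum_univ_two, Fin.sum_univ_two] at hry
    simp only [riem, Fin.sum_univ_two, hsy] at hry
    have e : ∀ k a, pd a (Γ k 1 0) y = pd a (Γ k 0 1) y := fun k a ↦
      pd_congr (by filter_upwards [hu.mem_nhds hy] with w hw using hsymm k w hw) a
    have c0 := hcot y hy 0 1 0
    have c1 := hcot y hy 0 1 1
    simp only [cotton, Fin.sum_univ_two, hsy, hric y hy] at c0 c1
    simp only [Fin.sum_univ_succ (n := 2)]
    have r10 := hric y hy
    have er : ∀ a, pd a (ric Γ 1 0) y = pd a (ric Γ 0 1) y := fun a ↦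
      pd_congr (by filter_upwards [hu.mem_nhds hy] with w hw using hric w hw) a
    -- Flatness by blocks: symmetry of Ricci, symmetry of `Γ`, vanishing of `cotton`, and the
    -- two-dimensional identity expressing the curvature through Ricci.
    refine Fin.cases (Fin.cases ?_ (fun k ↦ ?_) s) (fun j ↦ Fin.cases ?_ (fun k ↦ ?_) s) r
    · simp only [h00, h0s, hs0, pdc, Fin.sum_univ_two]
      simp [r10]
    · simp only [h00, h0s, hss, pdc, Fin.sum_univ_two]
      fin_cases k <;> simp [hsy]
    · simp only [h00, hs0, hss, pdn, Fin.sum_univ_two]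
      fin_cases j <;> simp [hsy, r10, er] at c0 c1 ⊢ <;> linarith
    · simp only [h0s, hs0, hss, Fin.sum_univ_two]
      fin_cases j <;> fin_cases k <;>
        simp [hsy, e, ric, riem, Fin.sum_univ_two] at hry ⊢ <;> linarith) hp
  have h1 : ∀ y ∈ W, ∀ (i : Fin 2) (a : Fin 3), pd i (F 0 a) y = F i.succ a y := by
    intro y hy i a
    rw [hF y hy, Fin.sum_univ_succ]
    simp [h00, h0s]
  refine ⟨W, F 0, hW, hpW, hWu, hFs 0, fun a ↦ hF1 0 a, fun i a ↦ ?_, fun a y hy i j ↦ ?_⟩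
  · rw [h1 p hpW, hF1]
  · have h2 : pd i (pd j (F 0 a)) y = pd i (F j.succ a) y := pd_congr (by
      filter_upwards [hW.mem_nhds hy] with z hz using h1 z hz j a) i
    rw [h2, hF y hy, Fin.sum_univ_succ]
    simp only [hs0, hss, h1 y hy]
    ring

end Tractors

end ProjectiveCoordinates

/-! ### Vanishing of `Y_abc` gives straightening coordinates. -/

section Straightening

section Lines

/-- Points satisfying a common nontrivial affine equation lie on a line. -/
lemma exists_line {J : Set ℝ} {z : ℝ → Plane} {a : Fin 3 → ℝ} (ha : a ≠ 0)
    (h : ∀ t ∈ J, a 0 + a 1 * z t 0 + a 2 * z t 1 = 0) :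
    ∃ L : AffineSubspace ℝ Plane, Module.finrank ℝ L.direction = 1 ∧ ∀ t ∈ J, z t ∈ L := by
  have hline : ∀ (q d : Plane), d ≠ 0 →
      Module.finrank ℝ (AffineSubspace.mk' q (Submodule.span ℝ {d})).direction = 1 := by
    intro q d hd
    rw [AffineSubspace.direction_mk']
    exact finrank_span_singleton hd
  rcases J.eq_empty_or_nonempty with rfl | ⟨t₀, ht₀⟩
  · exact ⟨_, hline 0 (stdVec 0) (by simp [stdVec]), by simp⟩
  -- Otherwise the equation at `t₀` would also force `a 0 = 0`.
  have h12 : a 1 ≠ 0 ∨ a 2 ≠ 0 := by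
    by_contra! h'
    refine ha (funext fun i ↦ ?_)
    have h0 := h t₀ ht₀
    simp only [h'.1, h'.2, zero_mul, add_zero] at h0
    fin_cases i
    · exact h0
    · exact h'.1
    · exact h'.2
  have hsq : a 1 ^ 2 + a 2 ^ 2 ≠ 0 := by
    rcases h12 with h' | h' <;> positivity
  refine ⟨_, hline (z t₀) !₂[-a 2, a 1] (fun h' ↦ ?_), fun t ht ↦ ?_⟩
  · have h0 := congrArg (· 0) h'
    have h1 := congrArg (· 1) h'
    simp at h0 h1
    tauto
  · rw [AffineSubspace.mem_mk', vsub_eq_sub, Submodule.mem_span_singleton]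
    refine ⟨(a 1 * (z t 1 - z t₀ 1) - a 2 * (z t 0 - z t₀ 0)) / (a 1 ^ 2 + a 2 ^ 2), ?_⟩
    have e := h t ht
    have e₀ := h t₀ ht₀
    ext i
    fin_cases i
    · simp
      field_simp
      linear_combination (-a 1) * e + a 1 * e₀
    · simp
      field_simp
      linear_combination (-a 2) * e + a 2 * e₀

/-- Uniqueness for scalar linear differential equations of the second order. -/
lemma eqOn_zero_of_second_order_ode {J : Set ℝ} (hJ : IsOpen J) (hJ' : J.OrdConnected)
    {f r w w' : ℝ → ℝ} (hf : ContinuousOn f J) (hr : ContinuousOn r J)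
    (hw : ∀ t ∈ J, HasDerivAt w (w' t) t)
    (hw' : ∀ t ∈ J, HasDerivAt w' (f t * w' t + r t * w t) t) {t₀ : ℝ} (ht₀ : t₀ ∈ J)
    (h0 : w t₀ = 0) (h1 : w' t₀ = 0) : ∀ t ∈ J, w t = 0 := by
  let P : ℝ × ℝ →L[ℝ] ℝ × ℝ := (ContinuousLinearMap.inl ℝ ℝ ℝ).comp (ContinuousLinearMap.snd ℝ ℝ ℝ)
  let Q : ℝ × ℝ →L[ℝ] ℝ × ℝ := (ContinuousLinearMap.inr ℝ ℝ ℝ).comp (ContinuousLinearMap.snd ℝ ℝ ℝ)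
  let R : ℝ × ℝ →L[ℝ] ℝ × ℝ := (ContinuousLinearMap.inr ℝ ℝ ℝ).comp (ContinuousLinearMap.fst ℝ ℝ ℝ)
  have key := eqOn_zero_of_linear_ode hJ hJ' (B := fun t ↦ P + f t • Q + r t • R)
    ((continuousOn_const.add (hf.smul continuousOn_const)).add (hr.smul continuousOn_const))
    (w := fun t ↦ (w t, w' t)) (fun t ht ↦ by
      refine ((hw t ht).prodMk (hw' t ht)).congr_deriv ?_
      simp [P, Q, R]) ht₀ (by simp [h0, h1])
  exact fun t ht ↦ congrArg Prod.fst (key t ht)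

variable {Γ : Symbols} {W : Set Plane}

/-- The derivatives of a solution of `∂_i ∂_j s = Γ^k_ij ∂_k s - R_ij s` along a geodesic. -/
lemma hasDerivAt_comp_geodesic (hW : IsOpen W) {s : Plane → ℝ} (hs : ContDiffOn ℝ ∞ s W)
    (hpde : ∀ y ∈ W, ∀ i j, pd i (pd j s) y = ∑ k, Γ k i j y * pd k s y - ric Γ i j y * s y)
    {J : Set ℝ} (hJ : IsOpen J) {c : ℝ → Plane} (hc : ContDiffOn ℝ ∞ c J) (hcW : MapsTo c J W)
    {f : ℝ → ℝ} (hgeo : ∀ t ∈ J, ∀ l, deriv (deriv c) t l +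
      ∑ i, ∑ k, deriv c t i * Γ l i k (c t) * deriv c t k = f t * deriv c t l) {t : ℝ}
    (ht : t ∈ J) :
    HasDerivAt (fun t ↦ s (c t)) (∑ i, deriv c t i * pd i s (c t)) t ∧
    HasDerivAt (fun t ↦ ∑ i, deriv c t i * pd i s (c t))
      (f t * (∑ i, deriv c t i * pd i s (c t)) +
        (-∑ i, ∑ k, deriv c t i * ric Γ i k (c t) * deriv c t k) * s (c t)) t := by
  have hcd : HasDerivAt c (deriv c t) t :=
    ((hc.contDiffAt (hJ.mem_nhds ht)).differentiableAt (by simp)).hasDerivAt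
  have hcdd : HasDerivAt (deriv c) (deriv (deriv c) t) t :=
    (((hc.deriv_of_isOpen (m := ∞) hJ (by simp)).contDiffAt
      (hJ.mem_nhds ht)).differentiableAt (by simp)).hasDerivAt
  have hchain : ∀ {g : Plane → ℝ}, ContDiffOn ℝ ∞ g W →
      HasDerivAt (fun t ↦ g (c t)) (∑ i, deriv c t i * pd i g (c t)) t := fun hg ↦ by
    rw [← fderiv_apply_eq_sum_pd]
    exact (hg.differentiableAt_of_isOpen hW (hcW ht)).hasFDerivAt.comp_hasDerivAt t hcd
  have hcomp : ∀ i : Fin 2, HasDerivAt (fun t ↦ deriv c t i) (deriv (deriv c) t i) t := fun i ↦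
    (EuclideanSpace.proj (𝕜 := ℝ) i).hasFDerivAt.comp_hasDerivAt t hcdd
  refine ⟨hchain hs, ?_⟩
  refine (HasDerivAt.fun_sum fun i _ ↦
    (hcomp i).mul (hchain (contDiffOn_pd hW hs i))).congr_deriv ?_
  have g0 := hgeo t ht 0
  have g1 := hgeo t ht 1
  simp only [hpde _ (hcW ht), Fin.sum_univ_two] at g0 g1 ⊢
  -- The `Γ` terms of the Hessian of `s` cancel those of the geodesic equation, leaving `w'' = f w'
  -- - Ric(c', c') w`.
  linear_combination pd 0 s (c t) * g0 + pd 1 s (c t) * g1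

/-- Along a geodesic, three solutions of `∂_i ∂_j s = Γ^k_ij ∂_k s - R_ij s` are linearly
dependent. -/
theorem exists_sum_mul_eq_zero (hW : IsOpen W) (hΓ : ∀ k i j, ContDiffOn ℝ ∞ (Γ k i j) W)
    {σ : Fin 3 → Plane → ℝ} (hs : ∀ a, ContDiffOn ℝ ∞ (σ a) W)
    (hpde : ∀ a, ∀ y ∈ W, ∀ i j, pd i (pd j (σ a)) y =
      ∑ k, Γ k i j y * pd k (σ a) y - ric Γ i j y * σ a y)
    {J : Set ℝ} (hJ : IsOpen J) (hJ' : J.OrdConnected) {c : ℝ → Plane} (hc : ContDiffOn ℝ ∞ c J)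
    (hcW : MapsTo c J W) {f : ℝ → ℝ} (hf : ContDiffOn ℝ ∞ f J)
    (hgeo : ∀ t ∈ J, ∀ l, deriv (deriv c) t l +
      ∑ i, ∑ k, deriv c t i * Γ l i k (c t) * deriv c t k = f t * deriv c t l) :
    ∃ a : Fin 3 → ℝ, a ≠ 0 ∧ ∀ t ∈ J, ∑ b, a b * σ b (c t) = 0 := by
  rcases J.eq_empty_or_nonempty with rfl | ⟨t₀, ht₀⟩
  · exact ⟨1, one_ne_zero, by simp⟩
  -- Vanishing of the combination and of its derivative at `t₀` is two conditions on three
  -- coefficients; uniqueness for the second-order equation propagates it to `J`.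
  let T : (Fin 3 → ℝ) →ₗ[ℝ] (Fin 2 → ℝ) := Matrix.toLin' (Matrix.of
    ![fun b ↦ σ b (c t₀), fun b ↦ ∑ i, deriv c t₀ i * pd i (σ b) (c t₀)])
  obtain ⟨a, haT, ha⟩ := (Submodule.ne_bot_iff _).1
    (LinearMap.ker_ne_bot_of_finrank_lt (f := T) (by simp))
  have hT := LinearMap.mem_ker.1 haT
  have hT0 := congrFun hT 0
  have hT1 := congrFun hT 1
  simp [T, Matrix.mulVec, dotProduct] at hT0 hT1
  refine ⟨a, ha, ?_⟩
  have hder := fun b t (ht : t ∈ J) ↦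
    hasDerivAt_comp_geodesic hW (hs b) (hpde b) hJ hc hcW hgeo ht
  have hc' : ContDiffOn ℝ ∞ (deriv c) J := hc.deriv_of_isOpen hJ (by simp)
  have hci : ∀ i : Fin 2, ContDiffOn ℝ ∞ (fun t ↦ deriv c t i) J := fun i ↦
    (EuclideanSpace.proj (𝕜 := ℝ) i).contDiff.comp_contDiffOn hc'
  refine eqOn_zero_of_second_order_ode hJ hJ' hf.continuousOn
    (r := fun t ↦ -∑ i, ∑ k, deriv c t i * ric Γ i k (c t) * deriv c t k)
    (w' := fun t ↦ ∑ b, a b * ∑ i, deriv c t i * pd i (σ b) (c t)) ?_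
    (fun t ht ↦ HasDerivAt.fun_sum fun b _ ↦ (hder b t ht).1.const_mul (a b)) (fun t ht ↦ ?_) ht₀
    ?_ ?_
  · refine ContinuousOn.neg (ContDiffOn.continuousOn (𝕜 := ℝ) (n := ∞) ?_)
    refine ContDiffOn.sum fun i _ ↦ ContDiffOn.sum fun k _ ↦ ?_
    exact ((hci i).mul ((contDiffOn_ric hW hΓ i k).comp hc hcW)).mul (hci k)
  · refine (HasDerivAt.fun_sum fun b _ ↦ (hder b t ht).2.const_mul (a b)).congr_deriv ?_
    rw [Finset.mul_sum, Finset.mul_sum, ← Finset.sum_add_distrib]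
    exact Finset.sum_congr rfl fun b _ ↦ by ring
  · simpa [mul_comm] using hT0
  · simpa [mul_comm] using hT1

end Lines

/-- The inverse function theorem for smooth maps. -/
lemma exists_openPartialHomeomorph {E : Type*} [NormedAddCommGroup E] [NormedSpace ℝ E]
    [CompleteSpace E] {f : E → E} {U : Set E} (hU : IsOpen U) (hf : ContDiffOn ℝ ∞ f U) {p : E}
    (hp : p ∈ U) (e : E ≃L[ℝ] E) (he : HasFDerivAt f (e : E →L[ℝ] E) p) :
    ∃ θ : OpenPartialHomeomorph E E, p ∈ θ.source ∧ θ.source ⊆ U ∧ (θ : E → E) = f ∧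
      ContDiffOn ℝ ∞ θ.symm θ.target := by
  have hfp : ContDiffAt ℝ ∞ f p := hf.contDiffAt (hU.mem_nhds hp)
  -- Restricting to points with invertible derivative makes the inverse smooth on the whole target,
  -- not only near `f p`.
  set V : Set E := U ∩ fderiv ℝ f ⁻¹' range ((↑) : (E ≃L[ℝ] E) → E →L[ℝ] E) with hV
  have hVo : IsOpen V := (hf.continuousOn_fderiv_of_isOpen hU (by simp)).isOpen_inter_preimage hU
    ContinuousLinearEquiv.isOpen
  have hpV : p ∈ V := ⟨hp, e, he.fderiv.symm⟩
  let θ₀ := hfp.toOpenPartialHomeomorph f he (by simp)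
  refine ⟨θ₀.restrOpen V hVo, ?_, ?_, rfl, ?_⟩
  · rw [OpenPartialHomeomorph.restrOpen_source]
    exact ⟨hfp.mem_toOpenPartialHomeomorph_source he (by simp), hpV⟩
  · rw [OpenPartialHomeomorph.restrOpen_source]
    exact fun x hx ↦ hx.2.1
  · intro y hy
    set θ := θ₀.restrOpen V hVo
    have hx : θ.symm y ∈ θ.source := θ.map_target hy
    rw [OpenPartialHomeomorph.restrOpen_source] at hx
    obtain ⟨e', he'⟩ := hx.2.2
    have hfx : ContDiffAt ℝ ∞ f (θ.symm y) := hf.contDiffAt (hU.mem_nhds hx.2.1)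
    refine (θ.contDiffAt_symm hy (f₀' := e') ?_ hfx).contDiffWithinAt
    rw [he']
    exact (hfx.differentiableAt (by simp)).hasFDerivAt

variable {M : Type*} [TopologicalSpace M] [T2Space M] [ChartedSpace Plane M]
  [IsManifold (𝓡 2) ∞ M] {φ : OpenPartialHomeomorph M Plane}
  {cov : Connection M} [cov.ContMDiffCovariantDerivative ∞]

lemma trans_mem_maximalAtlas (hφ : φ ∈ IsManifold.maximalAtlas (𝓡 2) ∞ M)
    {θ : OpenPartialHomeomorph Plane Plane} (hθ : ContDiffOn ℝ ∞ θ θ.source)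
    (hθ' : ContDiffOn ℝ ∞ θ.symm θ.target) :
    φ.trans θ ∈ IsManifold.maximalAtlas (𝓡 2) ∞ M := by
  refine OpenPartialHomeomorph.mem_maximalAtlas_of_contMDiffOn _ ?_ ?_
  · rw [OpenPartialHomeomorph.trans_source]
    exact hθ.contMDiffOn.comp ((contMDiffOn_of_mem_maximalAtlas hφ).mono inter_subset_left)
      fun x hx ↦ hx.2
  · rw [OpenPartialHomeomorph.trans_target]
    exact (contMDiffOn_symm_of_mem_maximalAtlas hφ).comp (hθ'.contMDiffOn.mono inter_subset_left)
      fun x hx ↦ hx.2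

/-- The equation of unparameterised geodesics in a chart. -/
lemma IsUnparamGeodesicOn.chart_eq (hφ : φ ∈ IsManifold.maximalAtlas (𝓡 2) ∞ M) {γ : ℝ → M}
    {J : Set ℝ} (hγ : IsUnparamGeodesicOn cov γ J) (hJ : MapsTo γ J φ.source) :
    ∃ f : ℝ → ℝ, ContDiffOn ℝ ∞ f J ∧ ∀ t ∈ J, ∀ l, deriv (deriv (φ ∘ γ)) t l +
      ∑ i, ∑ k, deriv (φ ∘ γ) t i * christoffel cov φ l i k ((φ ∘ γ) t) * deriv (φ ∘ γ) t k =
        f t * deriv (φ ∘ γ) t l := by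
  obtain ⟨f, hf, hacc⟩ := hγ.accel
  refine ⟨f, hf, fun t ht l ↦ ?_⟩
  have h := dchart_acceleration cov hφ hγ.isOpen hγ.smooth ht (hJ ht) l
  rw [hacc t ht, map_smul, dchart_velocity hφ (((hγ.smooth t ht).contMDiffAt
    (hγ.isOpen.mem_nhds ht)).mdifferentiableAt (by simp)) (hJ ht)] at h
  exact h.symm

theorem exists_geodesicsAreStraightIn (htor : cov.torsion = 0) (hsymm : HasSymmetricRicci cov)
    (hY : TensorYVanishes cov) (p : M) : ∃ φ ∈ IsManifold.maximalAtlas (𝓡 2) ∞ M,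
      p ∈ φ.source ∧ GeodesicsAreStraightIn cov φ := by
  set φ := chartAt Plane p
  have hφ : φ ∈ IsManifold.maximalAtlas (𝓡 2) ∞ M := IsManifold.chart_mem_maximalAtlas p
  have hp : p ∈ φ.source := mem_chart_source _ p
  set Γ := christoffel cov φ
  have hΓ := contDiffOn_christoffel cov hφ
  obtain ⟨W, σ, hW, hpW, hWφ, hσ, hσ0, hσ1, hpde⟩ := exists_projective_coordinates φ.open_target hΓ
    (fun k y hy ↦ christoffel_symm htor hφ hy k 1 0) (fun y hy ↦ ric_symm htor hφ hsymm hy 1 0)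
    (fun y hy ↦ cotton_eq_zero_of_tensorYVanishes htor hφ hY hy) (φ.map_source hp)
  set U : Set Plane := W ∩ σ 0 ⁻¹' {0}ᶜ
  have hU : IsOpen U := (hσ 0).continuousOn.isOpen_inter_preimage hW isOpen_compl_singleton
  have hpU : φ p ∈ U := ⟨hpW, by simp [hσ0]⟩
  let Ψ : Plane → Plane := fun y ↦ !₂[σ 1 y / σ 0 y, σ 2 y / σ 0 y]
  have hΨi : ∀ b, ContDiffOn ℝ ∞ (fun y ↦ σ b y / σ 0 y) U := fun b ↦
    ((hσ b).mono inter_subset_left).div ((hσ 0).mono inter_subset_left) fun y hy ↦ hy.2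
  have hΨ : ContDiffOn ℝ ∞ Ψ U := by
    rw [contDiffOn_euclidean]
    intro i
    fin_cases i
    · exact hΨi 1
    · exact hΨi 2
  -- At `φ p` one has `σ 0 = 1` and `dσ 0 = 0`, so dividing by `σ 0` does not change the
  -- differentials of `σ 1` and `σ 2`; hence `Ψ` has identity derivative there.
  have hpd : ∀ i b, pd i (fun y ↦ σ b y / σ 0 y) (φ p) = pd i (σ b) (φ p) := by
    intro i b
    have h : pd i (fun y ↦ σ b y / σ 0 y * σ 0 y) (φ p) = pd i (σ b) (φ p) := pd_congr (by
      filter_upwards [hU.mem_nhds hpU] with y hy using div_mul_cancel₀ _ hy.2) i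
    rw [pd_mul ((hΨi b).differentiableAt_of_isOpen hU hpU)
      ((hσ 0).differentiableAt_of_isOpen hW hpW), hσ1 i 0, hσ0 0] at h
    simpa using h
  have hΨd : HasFDerivAt Ψ ((ContinuousLinearEquiv.refl ℝ Plane : Plane ≃L[ℝ] Plane) :
      Plane →L[ℝ] Plane) (φ p) := by
    rw [← hasFDerivWithinAt_univ, hasFDerivWithinAt_euclidean]
    intro l
    rw [hasFDerivWithinAt_univ]
    have hd : DifferentiableAt ℝ (fun y ↦ Ψ y l) (φ p) :=
      (contDiffOn_coord hΨ l).differentiableAt_of_isOpen hU hpU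
    refine hd.hasFDerivAt.congr_fderiv (ContinuousLinearMap.ext fun w ↦ ?_)
    rw [fderiv_apply_eq_sum_pd]
    have e0 : (fun y ↦ Ψ y 0) = fun y ↦ σ 1 y / σ 0 y := rfl
    have e1 : (fun y ↦ Ψ y 1) = fun y ↦ σ 2 y / σ 0 y := rfl
    fin_cases l <;> simp [e0, e1, hpd, hσ1, Fin.sum_univ_two]
  obtain ⟨θ, hpθ, hθU, hθΨ, hθs⟩ := exists_openPartialHomeomorph hU hΨ hpU _ hΨd
  refine ⟨φ.trans θ, trans_mem_maximalAtlas hφ (hθΨ ▸ hΨ.mono hθU) hθs, ?_, ?_⟩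
  · rw [OpenPartialHomeomorph.trans_source]
    exact ⟨hp, hpθ⟩
  · intro γ J hγ hJ
    rw [OpenPartialHomeomorph.trans_source] at hJ
    have hJφ : MapsTo γ J φ.source := fun t ht ↦ (hJ ht).1
    have hJU : MapsTo (φ ∘ γ) J U := fun t ht ↦ hθU (hJ ht).2
    obtain ⟨f, hf, hgeo⟩ := hγ.chart_eq hφ hJφ
    obtain ⟨a, ha, haσ⟩ := exists_sum_mul_eq_zero hW (fun k i j ↦ (hΓ k i j).mono hWφ) hσ hpde
      hγ.isOpen hγ.ordConnected (contDiffOn_chart_comp hφ hγ.smooth hJφ)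
      (fun t ht ↦ (hJU ht).1) hf hgeo
    -- Division of the linear relation by `σ 0` turns it into an affine equation for the new
    -- coordinates.
    refine exists_line ha fun t ht ↦ ?_
    have h0 : σ 0 (φ (γ t)) ≠ 0 := (hJU ht).2
    have h := haσ t ht
    rw [Fin.sum_univ_three] at h
    simp only [Function.comp_apply] at h
    simp [hθΨ, Ψ]
    field_simp
    linear_combination h

end Straightening

end AffineSurface

end

theorem mainTheorem1 {M : Type*} [TopologicalSpace M] [T2Space M]
    [ChartedSpace AffineSurface.Plane M] [IsManifold (𝓡 2) ∞ M]
    (cov : AffineSurface.Connection M) [cov.ContMDiffCovariantDerivative ∞]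
    (htorsion : cov.torsion = 0) (hsymm : AffineSurface.HasSymmetricRicci cov) :
    AffineSurface.TensorYVanishes cov ↔
      ∀ p : M, ∃ φ ∈ IsManifold.maximalAtlas (𝓡 2) ∞ M, p ∈ φ.source ∧
        AffineSurface.GeodesicsAreStraightIn cov φ :=
  ⟨fun h p ↦ AffineSurface.exists_geodesicsAreStraightIn htorsion hsymm h p,
    fun h ↦ AffineSurface.tensorYVanishes_of_geodesicsAreStraightIn htorsion hsymm h⟩
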